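/- **Setting.** Statix terms are built from unification variables, constructor applications, labels and scopes. A *scope graph* $\mathcal G=\langle S,R,\rho\rangle$ consists of a set $S$ of scopes, a set $R$ of labelled edges $(s,l,s')$ and a partial map $\rho$ from scopes to terms (their data); $t\in\rho_{\mathcal G}(s)$ means that $t$ is a syntactic sub-term of the data of $s$. A *query* $q=(o,s,r,\lambda y.E)$ has a source scope $s$, a regular expression $r$ and a partial order $o$ on labels, and an equality constraint $E$ (built from $t=t'$, $\mathsf{dataOf}(t,t')$, conjunction and $\exists$). $\mathsf{Ans}(\mathcal G,q)$ is the set of paths $p$ of $\mathcal G$ from $s$ whose label word matches $r$, whose target $\mathsf{tgt}(p)$ satisfies $E$, and that are not shadowed by another such path in the lexicographic order on label words induced by $o$; it is defined only if it is finite and does not depend on the values of unification variables or on data still missing from $\mathcal G$. A *specification* $\mathbb S$ is a set of closed predicate rules $P(\bar t)\leftarrow C$. A *configuration* $\kappa=\langle\mathcal G\mid\overline C\mid U\mid H\rangle$ consists of a scope graph, a finite multiset of unsolved constraints, a partial map $U$ from unification variables to holes, and a partial map $H$ from holes to pairs $(\bar s,t)$ of a scope sequence and a term; it also records which queries have been solved.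 Applying a substitution $\theta$ to $\kappa$ is undefined if it would relate a variable to two different holes; where $\theta$ is defined, the variables of $x\theta$ become related to $U(x)$. *Solver steps* $\kappa\to\kappa'$ are those of Statix: they split conjunctions, drop $\mathsf{emp}$, open $\exists$ with a fresh variable, unify equalities, resolve singleton and $\forall$ constraints on set literals, create scopes and edges, look up data, replace a predicate constraint by the body of a rule if exactly one rule of $\mathbb S$ unifies with it, and replace a constraint $\mathsf{query}\ q\ \mathsf{as}\ z.\,C$ whose source is a scope by $C[A/z]$ with $A=\mathsf{Ans}(\mathcal G,q)$, provided that it is guarded (recording $q$ as solved). *Guarded* means that future steps of $C[A/z]$ and the other constraints (solver steps and expansions, queries being answered without regard to guards) cannot create a new edge $(s_1,l,s_2)$ such that some path of $\mathcal G$ from the source of $q$ to $s_1$, followed by $l$, spells a prefix of a word matching $r$. *Expansion steps* $\kappa\rightarrowtail\theta,H'$ are of two kinds. (i) For a predicate constraint $P(\bar t_1)$ and any rule $P(\bar t_2)\leftarrow C$ of $\mathbb S$ (with fresh variables), $\theta=\mathsf{mgu}(\bar t_1,\bar t_2)$ and $H'=H$. (ii) For a query constraint with source term $t$ and body $\lambda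 y.E$, choose a hole $h=U(x)$ with $x\in FV(E)$ and $H(h)=(s_t\cdot\bar s,t')$, and scopes $s',s''\in S$ with $s_t=s''$ or $s_t\in\rho_{\mathcal G}(s'')$; let $\theta_1=\mathsf{mgu}(t,s')$, let $\theta_2$ be a unifier produced by $E[s''/y]\theta_1$ in $\mathcal G$, and $\theta=\theta_1\theta_2$; if the answer to the query with source $s'$ and body $\lambda y.E\theta$ in $\mathcal G\theta$ contains a path to $s''$ and this query is guarded next to the other constraints under $\theta$, then $H'=H[h\mapsto(s'\cdot s_t\cdot\bar s,t')]$. $\kappa$ is *accepted* if $\overline C=\emptyset$ and every scope sequence in the range of $H$ has length $>1$. The *synthesis relation* $\twoheadrightarrowtail$ on collections of configurations replaces a member $\kappa$ by $\kappa'$ if $\kappa\to\kappa'$; if $\kappa$ has no solver step and is not accepted, it replaces $\kappa$ by all its expansions $\langle\mathcal G\mid\overline C\mid U\mid H'\rangle\theta$ with $\kappa\rightarrowtail\theta,H'$. For single configurations, $\kappa\twoheadrightarrowtail\kappa'$ means that $\{\kappa\}\twoheadrightarrowtail K$ for some $K\ni\kappa'$; and $\kappa_0\twoheadrightarrowtail^\bullet\kappa_1$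 means that $\kappa_0\twoheadrightarrowtail^*\kappa_1$ and $\kappa_1\twoheadrightarrowtail\kappa'$ for no $\kappa'$. Let $\mathcal P$ be a ground program with references locked to declarations $d_1,\dots,d_n$. A configuration $\kappa_0$ is *initialized by* $\mathsf{synthesize}(\mathcal P)$ if it arises as follows: replace the $i$-th locked reference by a fresh variable $x_i$ with $U(x_i)=h_i$ for a fresh hole $h_i$, giving $\mathcal P_0$; run $\langle\emptyset\mid P_0(\mathcal P_0)\mid U\mid\emptyset\rangle\to^*\kappa$, where $P_0$ is the initial predicate; set $H(h_i)=(s_{d_i},x_i)$ for a scope $s_{d_i}$ with $d_i\in\rho_{\mathcal G_\kappa}(s_{d_i})$ (undefined if there is none). If $\{\kappa_0\}\twoheadrightarrowtail^*K$ and $\kappa_1\in K$ is accepted, then $\mathsf{synthesize}(\mathcal P)$ yields the program $\mathcal P'$ obtained from $\mathcal P_0$ by replacing each $x_i$ by the term recorded for $h_i$ in $H_{\kappa_1}$. *Composite paths* in $\kappa$: every one-element sequence is a composite path; $s_1\cdot s_2\cdot\bar s$ is one if $s_2\cdot\bar s$ is one and there are a query $q$ with source $s_1$ that is solved in $\kappa$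 and a path $p\in\mathsf{Ans}(\mathcal G_\kappa,q)$ with $\mathsf{tgt}(p)=s_2$ or $s_2\in\rho_{\mathcal G_\kappa}(\mathsf{tgt}(p))$. **Theorem (Soundness 2).** Let $\kappa_0$ be initialized by $\mathsf{synthesize}(\mathcal P)$. 1. If $\kappa_0\twoheadrightarrowtail^\bullet\kappa_1$, then for every $(\bar s,t)=H_{\kappa_1}(h)$ the sequence $\bar s$ is a composite path in $\kappa_1$. Moreover $h=h_i$ for some $i$, the last scope of $\bar s$ is the scope $s_{d_i}$ that $h_i$ was given in $\kappa_0$, and $d_i\in\rho_{\mathcal G_{\kappa_1}}(s_{d_i})$. 2. If $\mathsf{synthesize}(\mathcal P)$ yields $\mathcal P'$ by a run from $\kappa_0$ with accepted configuration $\kappa_1$, then for each $i$ such that $d_i$ occurs in the data of some scope of $\mathcal G_{\kappa_0}$, the reference that $\mathcal P'$ contains for $d_i$ is the term recorded for $h_i$ in $\kappa_1$ together with a composite path of more than one scope, which ends in $s_{d_i}$, and $d_i\in\rho_{\mathcal G_{\kappa_1}}(s_{d_i})$. -/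

import Mathlib

open Relation

namespace RefSynth

/-- The sets of symbols of a Statix instance. Those from which fresh symbols are drawn are infinite. -/
structure Symbols where
  Ctor : Type
  Pred : Type
  Label : Type
  Var : Type
  Scope : Type
  Hole : Type
  infinite_var : Infinite Var
  infinite_scope : Infinite Scope
  infinite_hole : Infinite Hole

/-- Term constructors: those of the language, and the two that represent scope graph paths as terms. -/
inductive Con (L : Symbols) : Type
  | user (f : L.Ctor)
  | pathEnd
  | pathStep

/-! ### Terms and constraints

Binders are well-scoped de Bruijn indices (the innermost bound variable is `0`); unification variables
are the free variables `fvar x`. `Term L n` are the terms with `n` bound variables in scope, so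
`Term L 0` are the terms that occur in solver states. -/

inductive Term (L : Symbols) (n : ℕ) : Type
  | bvar (i : Fin n)
  | fvar (x : L.Var)
  | app (f : Con L) (k : ℕ) (ts : Fin k → Term L n)
  | label (l : L.Label)
  | scope (s : L.Scope)

namespace Term

variable {L : Symbols}

/-- Simultaneous substitution of the free variables (by `θ`) and of the bound variables (by `σ`). -/
def bind {n m : ℕ} (θ : L.Var → Term L m) (σ : Fin n → Term L m) : Term L n → Term L m
  | bvar i => σ i
  | fvar x => θ x
  | app f k ts => app f k (fun j => (ts j).bind θ σ)
  | label l => label l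
  | scope s => scope s

/-- Weakening under one more binder. -/
def shift {n : ℕ} (t : Term L n) : Term L (n + 1) := t.bind fvar (fun i => bvar i.succ)

/-- The substitution of bound variables `σ`, moved under one more binder. -/
def lift {n m : ℕ} (σ : Fin n → Term L m) : Fin (n + 1) → Term L (m + 1) :=
  Fin.cons (bvar 0) (fun i => (σ i).shift)

/-- The free (unification) variables of a term. -/
def fv {n : ℕ} : Term L n → Set L.Var
  | bvar _ => ∅
  | fvar x => {x}
  | app _ _ ts => ⋃ j, (ts j).fv
  | label _ => ∅
  | scope _ => ∅

/-- `u.SubtermOf t`: `u` is a syntactic sub-term of `t` (possibly `t` itself). -/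
def SubtermOf {n : ℕ} (u : Term L n) : Term L n → Prop
  | bvar i => u = bvar i
  | fvar x => u = fvar x
  | app f k ts => u = app f k ts ∨ ∃ j, u.SubtermOf (ts j)
  | label l => u = label l
  | scope s => u = scope s

end Term

/-- Substitutions of unification variables by terms; the identity outside their domain. -/
abbrev Subst (L : Symbols) : Type := L.Var → Term L 0

/-- Application of a substitution to a term of a solver state. -/
def Term.subst {L : Symbols} (θ : Subst L) (t : Term L 0) : Term L 0 := t.bind θ Fin.elim0

namespace Subst

variable {L : Symbols}

/-- `θ₁θ₂`: first `θ₁`, then `θ₂`. -/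
def comp (θ₁ θ₂ : Subst L) : Subst L := fun x => (θ₁ x).subst θ₂

open Classical in
/-- The substitution `[t/x]`. -/
noncomputable def single (x : L.Var) (t : Term L 0) : Subst L :=
  fun y => if y = x then t else .fvar y

/-- The variables mentioned by a substitution: its domain and the variables of its range. -/
def vars (θ : Subst L) : Set L.Var := {y | ∃ x, θ x ≠ .fvar x ∧ (y = x ∨ y ∈ (θ x).fv)}

/-- `θ` is the most general unifier of the tuples `a` and `b`: it unifies them, and every unifier
factors through it (as usual, most general unifiers are idempotent). -/
def IsMgu {ι : Type} (a b : ι → Term L 0) (θ : Subst L) : Prop :=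
  (∀ i, (a i).subst θ = (b i).subst θ) ∧
    ∀ τ : Subst L, (∀ i, (a i).subst τ = (b i).subst τ) → θ.comp τ = τ

/-- The most general unifier of two terms. -/
def IsMgu₁ (a b : Term L 0) (θ : Subst L) : Prop := IsMgu (fun _ : Unit => a) (fun _ => b) θ

end Subst

/-- Equality constraints `E`, with `n` bound variables in scope. -/
inductive EqConstraint (L : Symbols) : ℕ → Type
  | eq {n : ℕ} (t₁ t₂ : Term L n) : EqConstraint L n
  | dataOf {n : ℕ} (t₁ t₂ : Term L n) : EqConstraint L n
  | conj {n : ℕ} (E₁ E₂ : EqConstraint L n) : EqConstraint L n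
  | ex {n : ℕ} (E : EqConstraint L (n + 1)) : EqConstraint L n

namespace EqConstraint

variable {L : Symbols}

def bind : {n m : ℕ} → (L.Var → Term L m) → (Fin n → Term L m) →
    EqConstraint L n → EqConstraint L m
  | _, _, θ, σ, eq t₁ t₂ => eq (t₁.bind θ σ) (t₂.bind θ σ)
  | _, _, θ, σ, dataOf t₁ t₂ => dataOf (t₁.bind θ σ) (t₂.bind θ σ)
  | _, _, θ, σ, conj E₁ E₂ => conj (E₁.bind θ σ) (E₂.bind θ σ)
  | _, _, θ, σ, ex E => ex (E.bind (fun x => (θ x).shift) (Term.lift σ))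

def fv : {n : ℕ} → EqConstraint L n → Set L.Var
  | _, eq t₁ t₂ => t₁.fv ∪ t₂.fv
  | _, dataOf t₁ t₂ => t₁.fv ∪ t₂.fv
  | _, conj E₁ E₂ => E₁.fv ∪ E₂.fv
  | _, ex E => E.fv

/-- `E[t/y]`, for the body `E` of a binder `λ y. E` or `∃ y. E`. -/
def inst (E : EqConstraint L 1) (t : Term L 0) : EqConstraint L 0 :=
  E.bind .fvar (fun _ => t)

/-- Application of a substitution to an equality constraint of a solver state. -/
def subst (θ : Subst L) (E : EqConstraint L 0) : EqConstraint L 0 := E.bind θ Fin.elim0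

/-- Application of a substitution to the body `E` of an abstraction `λ y. E`. -/
def substBody (θ : Subst L) (E : EqConstraint L 1) : EqConstraint L 1 :=
  E.bind (fun x => (θ x).shift) Term.bvar

/-- `E` is true when the unification variables have the values `σ`, the bound variables the values
`e`, and the data of scopes is given by `ρ`. -/
def Holds (ρ : L.Scope → Option (Term L 0)) (σ : Subst L) :
    {n : ℕ} → (Fin n → Term L 0) → EqConstraint L n → Prop
  | _, e, eq t₁ t₂ => t₁.bind σ e = t₂.bind σ e
  | _, e, dataOf t₁ t₂ => ∃ s, t₁.bind σ e = .scope s ∧ ρ s = some (t₂.bind σ e)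
  | _, e, conj E₁ E₂ => Holds ρ σ e E₁ ∧ Holds ρ σ e E₂
  | _, e, ex E => ∃ t : Term L 0, Holds ρ σ (Fin.cons t e) E

end EqConstraint

/-- Set terms, with `n` bound term variables and `k` bound set variables in scope. A set literal
`∅ | {t} | ζ ⊔ ζ` is given by the list of its singletons. -/
inductive SetTerm (L : Symbols) (n k : ℕ) : Type
  | svar (z : Fin k)
  | lit (ζ : List (Term L n))

namespace SetTerm

variable {L : Symbols}

def bind {n m k j : ℕ} (θ : L.Var → Term L m) (σ : Fin n → Term L m) (τ : Fin k → SetTerm L m j) :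
    SetTerm L n k → SetTerm L m j
  | svar z => τ z
  | lit ζ => lit (ζ.map (Term.bind θ σ))

def fv {n k : ℕ} : SetTerm L n k → Set L.Var
  | svar _ => ∅
  | lit ζ => {x | ∃ t ∈ ζ, x ∈ t.fv}

/-- Weakening under one more binder of a term variable. -/
def shift {n k : ℕ} : SetTerm L n k → SetTerm L (n + 1) k :=
  bind (fun x => .fvar x) (fun i => .bvar i.succ) svar

/-- The substitution of bound set variables `τ`, moved under one more binder of a set variable. -/
def lift {n k j : ℕ} (τ : Fin k → SetTerm L n j) : Fin (k + 1) → SetTerm L n (j + 1) :=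
  Fin.cons (svar 0) (fun z => (τ z).bind .fvar .bvar (fun i => svar i.succ))

end SetTerm

/-- Constraints `C`, with `n` bound term variables and `k` bound set variables in scope. In
`query o t r E C`, the body `E` binds the target scope and `C` binds the set of answers. The equality
constraints are those built from `eq`, `dataOf`, `conj` and `ex`. -/
inductive Constraint (L : Symbols) : ℕ → ℕ → Type
  | emp {n k : ℕ} : Constraint L n k
  | fls {n k : ℕ} : Constraint L n k
  | conj {n k : ℕ} (C₁ C₂ : Constraint L n k) : Constraint L n k
  | ex {n k : ℕ} (C : Constraint L (n + 1) k) : Constraint L n k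
  | single {n k : ℕ} (t : Term L n) (ζ : SetTerm L n k) : Constraint L n k
  | all {n k : ℕ} (ζ : SetTerm L n k) (C : Constraint L (n + 1) k) : Constraint L n k
  | newScope {n k : ℕ} (t₁ t₂ : Term L n) : Constraint L n k
  | edge {n k : ℕ} (t₁ : Term L n) (l : L.Label) (t₂ : Term L n) : Constraint L n k
  | query {n k : ℕ} (o : PartialOrder L.Label) (t : Term L n) (r : RegularExpression L.Label)
      (E : EqConstraint L (n + 1)) (C : Constraint L n (k + 1)) : Constraint L n k
  | eq {n k : ℕ} (t₁ t₂ : Term L n) : Constraint L n k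
  | dataOf {n k : ℕ} (t₁ t₂ : Term L n) : Constraint L n k
  | pred {n k : ℕ} (P : L.Pred) (a : ℕ) (ts : Fin a → Term L n) : Constraint L n k

namespace Constraint

variable {L : Symbols}

/-- Simultaneous substitution of free variables, bound term variables and bound set variables. -/
def bind : {n m k j : ℕ} → (L.Var → Term L m) → (Fin n → Term L m) → (Fin k → SetTerm L m j) →
    Constraint L n k → Constraint L m j
  | _, _, _, _, _, _, _, emp => emp
  | _, _, _, _, _, _, _, fls => fls
  | _, _, _, _, θ, σ, τ, conj C₁ C₂ => conj (C₁.bind θ σ τ) (C₂.bind θ σ τ)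
  | _, _, _, _, θ, σ, τ, ex C =>
      ex (C.bind (fun x => (θ x).shift) (Term.lift σ) (fun z => (τ z).shift))
  | _, _, _, _, θ, σ, τ, single t ζ => single (t.bind θ σ) (ζ.bind θ σ τ)
  | _, _, _, _, θ, σ, τ, all ζ C =>
      all (ζ.bind θ σ τ) (C.bind (fun x => (θ x).shift) (Term.lift σ) (fun z => (τ z).shift))
  | _, _, _, _, θ, σ, _, newScope t₁ t₂ => newScope (t₁.bind θ σ) (t₂.bind θ σ)
  | _, _, _, _, θ, σ, _, edge t₁ l t₂ => edge (t₁.bind θ σ) l (t₂.bind θ σ)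
  | _, _, _, _, θ, σ, τ, query o t r E C =>
      query o (t.bind θ σ) r (E.bind (fun x => (θ x).shift) (Term.lift σ))
        (C.bind θ σ (SetTerm.lift τ))
  | _, _, _, _, θ, σ, _, eq t₁ t₂ => eq (t₁.bind θ σ) (t₂.bind θ σ)
  | _, _, _, _, θ, σ, _, dataOf t₁ t₂ => dataOf (t₁.bind θ σ) (t₂.bind θ σ)
  | _, _, _, _, θ, σ, _, pred P a ts => pred P a (fun i => (ts i).bind θ σ)

def fv : {n k : ℕ} → Constraint L n k → Set L.Var
  | _, _, emp => ∅
  | _, _, fls => ∅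
  | _, _, conj C₁ C₂ => C₁.fv ∪ C₂.fv
  | _, _, ex C => C.fv
  | _, _, single t ζ => t.fv ∪ ζ.fv
  | _, _, all ζ C => ζ.fv ∪ C.fv
  | _, _, newScope t₁ t₂ => t₁.fv ∪ t₂.fv
  | _, _, edge t₁ _ t₂ => t₁.fv ∪ t₂.fv
  | _, _, query _ t _ E C => t.fv ∪ E.fv ∪ C.fv
  | _, _, eq t₁ t₂ => t₁.fv ∪ t₂.fv
  | _, _, dataOf t₁ t₂ => t₁.fv ∪ t₂.fv
  | _, _, pred _ _ ts => ⋃ i, (ts i).fv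

/-- Application of a substitution; bound variables are left alone. -/
def subst {k : ℕ} (θ : Subst L) (C : Constraint L 0 k) : Constraint L 0 k :=
  C.bind θ Fin.elim0 SetTerm.svar

/-- Instantiation of the bound term variables by terms. -/
def inst {n : ℕ} (C : Constraint L n 0) (ts : Fin n → Term L 0) : Constraint L 0 0 :=
  C.bind .fvar ts SetTerm.svar

/-- `C[ζ/z]`, for the only bound set variable `z` of `C`. -/
def instSet (C : Constraint L 0 1) (ζ : List (Term L 0)) : Constraint L 0 0 :=
  C.bind .fvar Fin.elim0 (fun _ => .lit ζ)

end Constraint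

/-! ### Scope graphs, paths and query answers -/

structure ScopeGraph (L : Symbols) where
  S : Set L.Scope
  R : Set (L.Scope × L.Label × L.Scope)
  ρ : L.Scope → Option (Term L 0)

namespace ScopeGraph

variable {L : Symbols}

def empty (L : Symbols) : ScopeGraph L := ⟨∅, ∅, fun _ => none⟩

def subst (θ : Subst L) (G : ScopeGraph L) : ScopeGraph L :=
  ⟨G.S, G.R, fun s => (G.ρ s).map (Term.subst θ)⟩

def fv (G : ScopeGraph L) : Set L.Var := {x | ∃ s t, G.ρ s = some t ∧ x ∈ t.fv}

/-- `t ∈ ρ_G(s)`: `t` is a sub-term of the data associated with `s`. -/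
def InData (G : ScopeGraph L) (t : Term L 0) (s : L.Scope) : Prop :=
  ∃ d, G.ρ s = some d ∧ t.SubtermOf d

end ScopeGraph

inductive Path (L : Symbols) : Type
  | here (s : L.Scope)
  | step (s : L.Scope) (l : L.Label) (p : Path L)

namespace Path

variable {L : Symbols}

def src : Path L → L.Scope
  | here s => s
  | step s _ _ => s

def tgt : Path L → L.Scope
  | here s => s
  | step _ _ p => p.tgt

/-- The word of labels along a path. -/
def word : Path L → List L.Label
  | here _ => []
  | step _ l p => l :: p.word

/-- All edges of the path are edges of the graph. -/
def InGraph (G : ScopeGraph L) : Path L → Prop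
  | here _ => True
  | step s l p => (s, l, p.src) ∈ G.R ∧ p.InGraph G

/-- The term that represents a path. -/
def toTerm : Path L → Term L 0
  | here s => .app .pathEnd 1 ![.scope s]
  | step s l p => .app .pathStep 3 ![.scope s, .label l, p.toTerm]

end Path

/-- The lexicographic lifting of an order on labels to label words: `u` is preferred over `v` if at
the first position at which they differ, the label of `u` is smaller. -/
inductive WordLT {A : Type} (o : PartialOrder A) : List A → List A → Prop
  | head {a b : A} {u v : List A} : o.lt a b → WordLT o (a :: u) (b :: v)
  | cons {a : A} {u v : List A} : WordLT o u v → WordLT o (a :: u) (a :: v)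

/-- A query whose source is a scope, without the constraint that consumes its answer. -/
structure Query (L : Symbols) where
  ord : PartialOrder L.Label
  src : L.Scope
  re : RegularExpression L.Label
  wf : EqConstraint L 1

namespace Query

variable {L : Symbols}

/-- Application of a substitution to a query. -/
def subst (θ : Subst L) (q : Query L) : Query L := { q with wf := q.wf.substBody θ }

def fv (q : Query L) : Set L.Var := q.wf.fv

/-- The path leads from the source of the query along edges of the graph whose labels match the
regular expression. -/
def Reaches (q : Query L) (G : ScopeGraph L) (p : Path L) : Prop :=
  p.InGraph G ∧ p.src = q.src ∧ p.word ∈ q.re.matches'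

/-- The answer to a query when unification variables have the values `σ` and the data of scopes is
given by `ρ`: the reachable paths to targets that satisfy the data well-formedness constraint and
that are not shadowed by another such path. -/
def answer (q : Query L) (G : ScopeGraph L) (ρ : L.Scope → Option (Term L 0)) (σ : Subst L) :
    Set (Path L) :=
  {p | (q.Reaches G p ∧ q.wf.Holds ρ σ (fun _ => .scope p.tgt)) ∧
    ∀ p', q.Reaches G p' → q.wf.Holds ρ σ (fun _ => .scope p'.tgt) → ¬ WordLT q.ord p'.word p.word}

/-- `Ans(G, q) = A`. As `q` and the data in `G` may contain unification variables, and scopes may lack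
data, `Ans` is partial: it is defined if the answer is finite and is the same for all values of the
variables and all ways to complete the data of the graph. -/
def IsAns (q : Query L) (G : ScopeGraph L) (A : Set (Path L)) : Prop :=
  A.Finite ∧ ∀ (σ : Subst L) (ρ : L.Scope → Option (Term L 0)),
    (∀ s d, G.ρ s = some d → ρ s = some (d.subst σ)) → q.answer G ρ σ = A

/-- `p ∈ Ans(G, q)`. -/
def MemAns (q : Query L) (G : ScopeGraph L) (p : Path L) : Prop := ∃ A, q.IsAns G A ∧ p ∈ A

/-- An `l`-labelled edge out of `s`, if it were added to `G`, would be reached by the search for an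
answer to `q`: some path of `G` from the source of `q` to `s`, extended by `l`, spells a prefix of a
word that matches the regular expression. -/
def Critical (q : Query L) (G : ScopeGraph L) (s : L.Scope) (l : L.Label) : Prop :=
  ∃ p : Path L, p.InGraph G ∧ p.src = q.src ∧ p.tgt = s ∧
    ∃ w ∈ q.re.matches', p.word ++ [l] <+: w

end Query

/-- The set literal `ζ` consists of the terms that represent the paths in `A`. -/
def Represents {L : Symbols} (ζ : List (Term L 0)) (A : Set (Path L)) : Prop :=
  ∀ t, t ∈ ζ ↔ ∃ p ∈ A, t = p.toTerm

/-! ### Specifications and configurations -/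

/-- A closed rule `P(ts) ← C`; it binds `n` variables. -/
structure Rule (L : Symbols) where
  n : ℕ
  head : L.Pred
  arity : ℕ
  params : Fin arity → Term L n
  body : Constraint L n 0
  closed : (∀ i, (params i).fv = ∅) ∧ body.fv = ∅

abbrev Spec (L : Symbols) : Type := Set (Rule L)

namespace Rule

variable {L : Symbols}

/-- Some instance of the head of the rule is an instance of `P(ts)`, i.e. the head of the rule
(with its variables renamed apart) and `P(ts)` are unifiable. -/
def Applicable (D : Rule L) (P : L.Pred) (a : ℕ) (ts : Fin a → Term L 0) : Prop :=
  D.head = P ∧ ∃ h : a = D.arity, ∃ (θ : Subst L) (σ : Fin D.n → Term L 0),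
    ∀ i, (ts i).subst θ = (D.params (Fin.cast h i)).bind .fvar σ

/-- `θ` is the most general unifier of `ts` and the parameters of the rule, after the variables of
the rule are renamed to distinct variables `xs` outside of `avoid`. -/
def Unifies (D : Rule L) (avoid : Set L.Var) (P : L.Pred) (a : ℕ) (ts : Fin a → Term L 0)
    (xs : Fin D.n → L.Var) (θ : Subst L) : Prop :=
  D.head = P ∧ Function.Injective xs ∧ (∀ i, xs i ∉ avoid) ∧ ∃ h : a = D.arity,
    Subst.IsMgu ts (fun i => (D.params (Fin.cast h i)).bind .fvar (fun j => .fvar (xs j))) θ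

/-- The body of the rule, after the variables of the rule are renamed to `xs`. -/
def bodyAt (D : Rule L) (xs : Fin D.n → L.Var) : Constraint L 0 0 :=
  D.body.inst (fun j => .fvar (xs j))

end Rule

/-- Configurations. The last component records the queries that have been solved. -/
structure Config (L : Symbols) where
  G : ScopeGraph L
  C : Multiset (Constraint L 0 0)
  U : L.Var → Option L.Hole
  H : L.Hole → Option (List L.Scope × Term L 0)
  solved : List (Query L)

namespace Config

variable {L : Symbols}

/-- The variables in use in a configuration. -/
def vars (κ : Config L) : Set L.Var :=
  {x | x ∈ κ.G.fv ∨ (∃ C ∈ κ.C, x ∈ C.fv) ∨ κ.U x ≠ none ∨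
    (∃ h v, κ.H h = some v ∧ x ∈ v.2.fv) ∨ ∃ q ∈ κ.solved, x ∈ q.fv}

/-- The application of `θ` to `U` is defined: a variable that is related to a hole is mapped to a
term none of whose variables is, or becomes, related to another hole. -/
def UDefined (U : L.Var → Option L.Hole) (θ : Subst L) : Prop :=
  ∀ x h, U x = some h → ∀ y ∈ (θ x).fv,
    (∀ h', U y = some h' → h' = h) ∧
    ∀ x' h', U x' = some h' → y ∈ (θ x').fv → h' = h

open Classical in
/-- The application of `θ` to `U`: the variables of `θ x` become related to the hole of `x`. -/
noncomputable def substU (U : L.Var → Option L.Hole) (θ : Subst L) : L.Var → Option L.Hole :=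
  fun y => if hy : ∃ h x, U x = some h ∧ y ∈ (θ x).fv then some hy.choose else U y

/-- `κθ`, meaningful if `UDefined κ.U θ`. -/
noncomputable def subst (θ : Subst L) (κ : Config L) : Config L where
  G := κ.G.subst θ
  C := κ.C.map (Constraint.subst θ)
  U := substU κ.U θ
  H := fun h => (κ.H h).map (fun v => (v.1, v.2.subst θ))
  solved := κ.solved.map (Query.subst θ)

/-- All constraints are solved, and every hole has a path of more than one scope. -/
def Accept (κ : Config L) : Prop :=
  κ.C = 0 ∧ ∀ h ss t, κ.H h = some (ss, t) → 1 < ss.length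

end Config

/-! ### Operational semantics

The relations of the solver are first given relative to a predicate `g`, used as the guard of
queries; then the guard itself is defined. -/

/-- `g G q C Γ` is the guard of the query `q`, with continuation `C`, next to the constraints `Γ`. -/
abbrev GuardPred (L : Symbols) : Type :=
  ScopeGraph L → Query L → Constraint L 0 1 → Multiset (Constraint L 0 0) → Prop

section Semantics

variable {L : Symbols}

/-- `f[a ↦ b]`. -/
noncomputable def upd {A B : Type} (f : A → Option B) (a : A) (b : B) : A → Option B :=
  open Classical in Function.update f a (some b)

/-- One step of the Statix solver. -/
inductive Step (𝕊 : Spec L) (g : GuardPred L) : Config L → Config L → Prop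
  | conj {G C₁ C₂ Γ U H Q} :
      Step 𝕊 g ⟨G, .conj C₁ C₂ ::ₘ Γ, U, H, Q⟩ ⟨G, C₁ ::ₘ C₂ ::ₘ Γ, U, H, Q⟩
  | emp {G Γ U H Q} :
      Step 𝕊 g ⟨G, .emp ::ₘ Γ, U, H, Q⟩ ⟨G, Γ, U, H, Q⟩
  | ex {G C Γ U H Q} (y : L.Var) :
      y ∉ Config.vars ⟨G, .ex C ::ₘ Γ, U, H, Q⟩ →
      Step 𝕊 g ⟨G, .ex C ::ₘ Γ, U, H, Q⟩ ⟨G, C.inst (fun _ => .fvar y) ::ₘ Γ, U, H, Q⟩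
  | eq {G t₁ t₂ Γ U H Q} (θ : Subst L) :
      Subst.IsMgu₁ t₁ t₂ θ → Config.UDefined U θ →
      Step 𝕊 g ⟨G, .eq t₁ t₂ ::ₘ Γ, U, H, Q⟩ (Config.subst θ ⟨G, Γ, U, H, Q⟩)
  | single {G t ζ t' Γ U H Q} :
      (∀ u, u ∈ ζ ↔ u = t') →
      Step 𝕊 g ⟨G, .single t (.lit ζ) ::ₘ Γ, U, H, Q⟩ ⟨G, .eq t t' ::ₘ Γ, U, H, Q⟩
  | all {G ζ C Γ U H Q} (ts : List (Term L 0)) :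
      ts.Nodup → (∀ t, t ∈ ts ↔ t ∈ ζ) →
      Step 𝕊 g ⟨G, .all (.lit ζ) C ::ₘ Γ, U, H, Q⟩
        ⟨G, (ts.map fun t => C.inst (fun _ => t) : Multiset (Constraint L 0 0)) + Γ, U, H, Q⟩
  | newScope {S R ρ x t Γ U H Q} (s : L.Scope) :
      s ∉ S → Config.UDefined U (Subst.single x (.scope s)) →
      Step 𝕊 g ⟨⟨S, R, ρ⟩, .newScope (.fvar x) t ::ₘ Γ, U, H, Q⟩
        (Config.subst (Subst.single x (.scope s)) ⟨⟨insert s S, R, upd ρ s t⟩, Γ, U, H, Q⟩)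
  | edge {S R ρ s₁ l s₂ Γ U H Q} :
      Step 𝕊 g ⟨⟨S, R, ρ⟩, .edge (.scope s₁) l (.scope s₂) ::ₘ Γ, U, H, Q⟩
        ⟨⟨S, insert (s₁, l, s₂) R, ρ⟩, Γ, U, H, Q⟩
  | dataOf {G s t₁ t₂ Γ U H Q} :
      G.ρ s = some t₂ →
      Step 𝕊 g ⟨G, .dataOf (.scope s) t₁ ::ₘ Γ, U, H, Q⟩ ⟨G, .eq t₁ t₂ ::ₘ Γ, U, H, Q⟩
  | query {G o s r E C Γ U H Q} (A : Set (Path L)) (ζ : List (Term L 0)) :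
      Query.IsAns ⟨o, s, r, E⟩ G A → Represents ζ A → g G ⟨o, s, r, E⟩ C Γ →
      Step 𝕊 g ⟨G, .query o (.scope s) r E C ::ₘ Γ, U, H, Q⟩
        ⟨G, C.instSet ζ ::ₘ Γ, U, H, ⟨o, s, r, E⟩ :: Q⟩
  | pred {G P a ts Γ U H Q} (D : Rule L) (xs : Fin D.n → L.Var) (θ : Subst L) :
      D ∈ 𝕊 → (∀ D' ∈ 𝕊, D'.Applicable P a ts → D' = D) →
      D.Unifies (Config.vars ⟨G, .pred P a ts ::ₘ Γ, U, H, Q⟩) P a ts xs θ →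
      Config.UDefined U θ →
      Step 𝕊 g ⟨G, .pred P a ts ::ₘ Γ, U, H, Q⟩ (Config.subst θ ⟨G, D.bodyAt xs ::ₘ Γ, U, H, Q⟩)

/-- `G ⊢ E ⇝ θ`, where the variables in `avoid` are not fresh. -/
inductive EqSolve (G : ScopeGraph L) : Set L.Var → EqConstraint L 0 → Subst L → Prop
  | eq {avoid t₁ t₂ θ} : Subst.IsMgu₁ t₁ t₂ θ → EqSolve G avoid (.eq t₁ t₂) θ
  | dataOf {avoid s d t θ} : G.ρ s = some d → Subst.IsMgu₁ d t θ →
      EqSolve G avoid (.dataOf (.scope s) t) θ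
  | conj {avoid E₁ E₂ θ₁ θ₂} : EqSolve G avoid E₁ θ₁ → EqSolve G (avoid ∪ θ₁.vars) E₂ θ₂ →
      EqSolve G avoid (.conj E₁ E₂) (θ₁.comp θ₂)
  | ex {avoid E θ} (y : L.Var) : y ∉ avoid → EqSolve G (insert y avoid) (E.inst (.fvar y)) θ →
      EqSolve G avoid (.ex E) θ

/-- `κ ⤚ θ, H'`: speculative expansion of a predicate or a query. -/
inductive Expand (𝕊 : Spec L) (g : GuardPred L) :
    Config L → Subst L → (L.Hole → Option (List L.Scope × Term L 0)) → Prop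
  | pred {G P a ts Γ U H Q} (D : Rule L) (xs : Fin D.n → L.Var) (θ : Subst L) :
      D ∈ 𝕊 → D.Unifies (Config.vars ⟨G, .pred P a ts ::ₘ Γ, U, H, Q⟩) P a ts xs θ →
      Expand 𝕊 g ⟨G, .pred P a ts ::ₘ Γ, U, H, Q⟩ θ H
  | query {G o t r E C Γ U H Q} (h : L.Hole) (x : L.Var) (sₜ : L.Scope) (ss : List L.Scope)
      (t' : Term L 0) (s' s'' : L.Scope) (θ₁ θ₂ : Subst L) (p : Path L) :
      x ∈ E.fv → U x = some h →
      H h = some (sₜ :: ss, t') →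
      s' ∈ G.S → s'' ∈ G.S →
      Subst.IsMgu₁ t (.scope s') θ₁ →
      (sₜ = s'' ∨ G.InData (.scope sₜ) s'') →
      EqSolve G (Config.vars ⟨G, .query o t r E C ::ₘ Γ, U, H, Q⟩ ∪ θ₁.vars)
        ((E.inst (.scope s'')).subst θ₁) θ₂ →
      Query.MemAns ⟨o, s', r, E.substBody (θ₁.comp θ₂)⟩ (G.subst (θ₁.comp θ₂)) p →
      p.tgt = s'' →
      g (G.subst (θ₁.comp θ₂)) ⟨o, s', r, E.substBody (θ₁.comp θ₂)⟩ (C.subst (θ₁.comp θ₂))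
        (Γ.map (Constraint.subst (θ₁.comp θ₂))) →
      Expand 𝕊 g ⟨G, .query o t r E C ::ₘ Γ, U, H, Q⟩ (θ₁.comp θ₂)
        (upd H h (s' :: sₜ :: ss, t'))

/-- A step that the constraints `κ.C` might make in the future: a solver step or a speculative
expansion, where queries are answered without regard to their guard, and for any association of
variables with holes and any state of the holes. -/
inductive FutureStep (𝕊 : Spec L) :
    ScopeGraph L × Multiset (Constraint L 0 0) → ScopeGraph L × Multiset (Constraint L 0 0) → Prop
  | solve {κ κ' : Config L} : Step 𝕊 (fun _ _ _ _ => True) κ κ' →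
      FutureStep 𝕊 (κ.G, κ.C) (κ'.G, κ'.C)
  | expand {κ : Config L} {θ H'} : Expand 𝕊 (fun _ _ _ _ => True) κ θ H' →
      FutureStep 𝕊 (κ.G, κ.C) (κ.G.subst θ, κ.C.map (Constraint.subst θ))

/-- `Γ ↪ (s, l)`: in the graph `G`, future steps of the constraints `Γ` might create a new
`l`-labelled edge out of `s`. -/
def MightExtend (𝕊 : Spec L) (G : ScopeGraph L) (Γ : Multiset (Constraint L 0 0))
    (s : L.Scope) (l : L.Label) : Prop :=
  ∃ G' Γ' s', ReflTransGen (FutureStep 𝕊) (G, Γ) (G', Γ') ∧ (s, l, s') ∈ G'.R ∧ (s, l, s') ∉ G.R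

/-- The guard of a query: once the query is answered, its continuation `C` and the other constraints
`Γ` cannot create an edge that could change the answer. -/
def guard (𝕊 : Spec L) : GuardPred L := fun G q C Γ =>
  ∀ A ζ, q.IsAns G A → Represents ζ A →
    ∀ s l, q.Critical G s l → ¬ MightExtend 𝕊 G (C.instSet ζ ::ₘ Γ) s l

/-- `𝕊 ⊢ κ → κ'`. -/
def Solve (𝕊 : Spec L) : Config L → Config L → Prop := Step 𝕊 (guard 𝕊)

/-- The configurations that result from a speculative expansion of `κ`. -/
def expansions (𝕊 : Spec L) (κ : Config L) : Set (Config L) :=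
  {κ' | ∃ θ H', Expand 𝕊 (guard 𝕊) κ θ H' ∧ Config.UDefined κ.U θ ∧
    κ' = Config.subst θ { κ with H := H' }}

/-- `𝕊 ⊢ K ↠ K'`: one configuration in the collection `K` is replaced by its successors. -/
inductive SynthStep (𝕊 : Spec L) : Set (Config L) → Set (Config L) → Prop
  | solve {K κ κ'} : κ ∈ K → Solve 𝕊 κ κ' → SynthStep 𝕊 K (insert κ' (K \ {κ}))
  | expand {K κ} : κ ∈ K → (¬ ∃ κ', Solve 𝕊 κ κ') → ¬ κ.Accept →
      SynthStep 𝕊 K (expansions 𝕊 κ ∪ (K \ {κ}))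

/-- `κ ↠ κ'` on single configurations: `κ'` is among the results of a step from `κ`. -/
def Synth (𝕊 : Spec L) (κ κ' : Config L) : Prop := ∃ K', SynthStep 𝕊 {κ} K' ∧ κ' ∈ K'

/-- Exhaustive application of a relation. -/
def Exhaustively {A : Type} (R : A → A → Prop) (a b : A) : Prop :=
  ReflTransGen R a b ∧ ¬ ∃ c, R b c

end Semantics

/-! ### The synthesizer -/

/-- A program with locked references: a ground program context, whose `i`-th hole is a reference
that is locked to the declaration `decl i`. -/
structure LockedProgram (L : Symbols) where
  n : ℕ
  ctx : Term L n
  decl : Fin n → Term L 0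
  ground : ctx.fv = ∅ ∧ ∀ i, (decl i).fv = ∅

/-- The program in which terms have been filled in for the locked references. -/
def LockedProgram.fill {L : Symbols} (P : LockedProgram L) (ts : Fin P.n → Term L 0) : Term L 0 :=
  P.ctx.bind .fvar ts

section Synthesize

variable {L : Symbols}

/-- The configuration in which the solver is started: the initial constraint `P₀` on the program with
a fresh variable `xs i`, related to a fresh hole `hs i`, for each locked reference. -/
def IsStart (P₀ : L.Pred) (P : LockedProgram L) (xs : Fin P.n → L.Var) (hs : Fin P.n → L.Hole)
    (κ : Config L) : Prop :=
  Function.Injective xs ∧ Function.Injective hs ∧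
    κ.G = ScopeGraph.empty L ∧
    κ.C = {.pred P₀ 1 (fun _ => P.fill (fun i => .fvar (xs i)))} ∧
    (∀ i, κ.U (xs i) = some (hs i)) ∧ (∀ x h, κ.U x = some h → ∃ i, x = xs i) ∧
    (∀ h, κ.H h = none) ∧ κ.solved = []

/-- `κ₀` is initialized by `synthesize`: the solver has been run on the program with holes, and then
each hole has been given a scope whose data contains the declaration it is locked to (if any). -/
def InitializedBySynthesize (𝕊 : Spec L) (P₀ : L.Pred) (P : LockedProgram L)
    (xs : Fin P.n → L.Var) (hs : Fin P.n → L.Hole) (κ₀ : Config L) : Prop :=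
  (∃ κ κ', IsStart P₀ P xs hs κ ∧ ReflTransGen (Solve 𝕊) κ κ' ∧ κ₀ = { κ' with H := κ₀.H }) ∧
    (∀ i, (∃ s, κ₀.G.InData (P.decl i) s) → κ₀.H (hs i) ≠ none) ∧
    (∀ h v, κ₀.H h = some v →
      ∃ i s, h = hs i ∧ κ₀.G.InData (P.decl i) s ∧ v = ([s], .fvar (xs i)))

/-- The reference synthesized for the `i`-th locked reference in the configuration `κ`. -/
def reference {P : LockedProgram L} (xs : Fin P.n → L.Var) (hs : Fin P.n → L.Hole) (κ : Config L)
    (i : Fin P.n) : Term L 0 :=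
  match κ.H (hs i) with
  | some (_, t) => t
  | none => .fvar (xs i)

/-- `synthesize(P) = P'`, by a run from `κ₀` in which the accepted configuration `κ₁` is found. -/
def Synthesizes (𝕊 : Spec L) (P₀ : L.Pred) (P : LockedProgram L)
    (xs : Fin P.n → L.Var) (hs : Fin P.n → L.Hole) (κ₀ κ₁ : Config L) (P' : Term L 0) : Prop :=
  InitializedBySynthesize 𝕊 P₀ P xs hs κ₀ ∧
    (∃ K, ReflTransGen (SynthStep 𝕊) {κ₀} K ∧ κ₁ ∈ K) ∧ κ₁.Accept ∧
    P' = P.fill (reference xs hs κ₁)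

/-- `κ ⊢ ss cp`: the scopes `ss` form a composite path. -/
inductive CompositePath (κ : Config L) : List L.Scope → Prop
  | single (s : L.Scope) : CompositePath κ [s]
  | comp {s₁ s₂ : L.Scope} {ss : List L.Scope} (q : Query L) (p : Path L) :
      q ∈ κ.solved → q.src = s₁ → q.MemAns κ.G p →
      (p.tgt = s₂ ∨ κ.G.InData (.scope s₂) p.tgt) →
      CompositePath κ (s₂ :: ss) → CompositePath κ (s₁ :: s₂ :: ss)

/-- `κ wf_H`: the scopes recorded for each hole form a composite path. -/
def WellFormedH (κ : Config L) : Prop :=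
  ∀ h ss t, κ.H h = some (ss, t) → CompositePath κ ss

end Synthesize

end RefSynth

open RefSynth

/-! A query expansion records a new scope for a hole before the query is solved, so composite paths
are not themselves invariant. The invariant (`Config.Invariant`) instead asks for chains of `Linked`
scopes: each link is witnessed by a query with a defined answer that is either solved or still
pending, and in both cases safe. Safe means that no future step of the constraints can create an
edge that the search for the answer would reach. For a pending query, the constraints meant are
those in which the query is already replaced by its answered continuation.

Safety keeps answers fixed. A path using new edges leaves the old graph at a first new edge. If the
path matches the query, that edge is critical, so the reachable paths do not change. Substitution
and completion of data do not matter either, because an answer is by definition the same for all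
values and completions (`Query.IsAns.evolves`). Safety is itself preserved by steps, since futures
of a successor are futures of the original state (`Query.Safe.step`).

For a pending query, a solver step either solves it, with the same answer as before, or acts on
another constraint. In the latter case the same step, without guards, is possible next to the
answered continuation, whose future the guard controls (`Step.exists_evolves`). Expansions occur
only when no solver step exists, whereas a pending query can always be solved
(`Config.Pending.exists_solve`). Hence no expansion has to carry an old pending link along; the link
it adds is pending by the premises of the expansion rule.

At the end nothing is pending, either because no step remains or because no constraint remains. All
links are then solved queries, and chains of them are composite paths. The last scope of a chain
never changes, since scopes are only prepended. Declarations are ground, so they remain in the data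
of their scopes under substitution. -/

namespace RefSynth

variable {L : Symbols}

/-! ### Substitution -/

namespace Term

theorem bind_bind {n m k : ℕ} (θ : L.Var → Term L m) (σ : Fin n → Term L m)
    (θ' : L.Var → Term L k) (σ' : Fin m → Term L k) (t : Term L n) :
    (t.bind θ σ).bind θ' σ' = t.bind (fun x => (θ x).bind θ' σ') (fun i => (σ i).bind θ' σ') := by
  induction t with
  | app f k ts ih => simp only [bind, ih]
  | _ => simp only [bind]

theorem bind_id {n : ℕ} (t : Term L n) : t.bind fvar bvar = t := by
  induction t with
  | app f k ts ih => simp only [bind, ih]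
  | _ => simp only [bind]

theorem bind_fvar_elim0 (t : Term L 0) (σ : Fin 0 → Term L 0) : t.bind fvar σ = t := by
  rw [Subsingleton.elim σ bvar, bind_id]

theorem shift_bind {n m : ℕ} (t : Term L n) (θ : L.Var → Term L m) (σ : Fin (n + 1) → Term L m) :
    t.shift.bind θ σ = t.bind θ (fun i => σ i.succ) := by
  simp only [shift, bind_bind, bind]

theorem shift_bind_lift {n m : ℕ} (t : Term L n) (θ : L.Var → Term L m) (σ : Fin n → Term L m) :
    t.shift.bind (fun x => (θ x).shift) (lift σ) = (t.bind θ σ).shift := by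
  rw [shift_bind, shift, bind_bind]; simp only [lift, Fin.cons_succ]; rfl

theorem lift_bvar {n : ℕ} : lift (bvar : Fin n → Term L n) = bvar := by
  funext i
  refine Fin.cases ?_ (fun i => ?_) i <;> simp [lift, shift, bind]

theorem lift_bind_lift {n m k : ℕ} (σ : Fin n → Term L m) (θ : L.Var → Term L k)
    (σ' : Fin m → Term L k) (i : Fin (n + 1)) :
    (lift σ i).bind (fun x => (θ x).shift) (lift σ') = lift (fun i => (σ i).bind θ σ') i := by
  refine Fin.cases ?_ (fun i => ?_) i
  · simp [lift, bind]
  · have := shift_bind_lift (σ i) θ σ'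
    simpa [lift] using this

/-- The bound `V` is arbitrary so that the analogues for constraints can pass under binders. These
bounds serve to show that answered continuations mention no new variables and do not disturb
freshness conditions. -/
theorem fv_bind_subset {n m : ℕ} {V : Set L.Var} (θ : L.Var → Term L m) (σ : Fin n → Term L m)
    (t : Term L n) (hθ : ∀ x ∈ t.fv, (θ x).fv ⊆ V) (hσ : ∀ i, (σ i).fv ⊆ V) :
    (t.bind θ σ).fv ⊆ V := by
  induction t with
  | app f k ts ih =>
    simp only [bind, fv, Set.iUnion_subset_iff]
    exact fun j => ih j fun x hx => hθ x (Set.mem_iUnion.2 ⟨j, hx⟩)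
  | bvar i => exact hσ i
  | fvar x => exact hθ x rfl
  | _ => simp [bind, fv]

theorem fv_shift_subset {n : ℕ} (t : Term L n) : t.shift.fv ⊆ t.fv :=
  fv_bind_subset _ _ t (fun x hx => by simpa [fv] using hx) (fun i => by simp [fv])

theorem fv_lift_subset {n m : ℕ} {V : Set L.Var} {σ : Fin n → Term L m}
    (hσ : ∀ i, (σ i).fv ⊆ V) (i : Fin (n + 1)) : (lift σ i).fv ⊆ V := by
  refine Fin.cases ?_ (fun i => ?_) i
  · simp [lift, fv]
  · simpa [lift] using (fv_shift_subset _).trans (hσ i)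

theorem bind_eq_of_fv_eq_empty {n : ℕ} (θ : L.Var → Term L n) (t : Term L n) (h : t.fv = ∅) :
    t.bind θ bvar = t := by
  induction t with
  | app f k ts ih =>
    simp only [fv, Set.iUnion_eq_empty] at h
    simp only [bind, ih _ (h _)]
  | fvar x => simp [fv] at h
  | _ => simp only [bind]

theorem subst_eq_of_fv_eq_empty (θ : Subst L) (t : Term L 0) (h : t.fv = ∅) : t.subst θ = t := by
  rw [subst, Subsingleton.elim Fin.elim0 bvar, bind_eq_of_fv_eq_empty θ t h]

theorem subst_fvar (t : Term L 0) : t.subst fvar = t := bind_fvar_elim0 t _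

theorem subst_subst (θ θ' : Subst L) (t : Term L 0) :
    (t.subst θ).subst θ' = t.subst (θ.comp θ') := by
  simp only [subst, bind_bind]
  congr 1
  exact Subsingleton.elim _ _

theorem SubtermOf.bind {n m : ℕ} (θ : L.Var → Term L m) (σ : Fin n → Term L m) {u t : Term L n}
    (h : u.SubtermOf t) : (u.bind θ σ).SubtermOf (t.bind θ σ) := by
  have refl : ∀ t : Term L m, t.SubtermOf t := fun t => by cases t <;> simp [SubtermOf]
  induction t with
  | app f k ts ih =>
    rcases h with rfl | ⟨j, h⟩
    · exact refl _
    · exact Or.inr ⟨j, ih j h⟩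
  | _ => cases h; exact refl _

end Term

/-! ### Substitution and truth of equality constraints -/

namespace EqConstraint

theorem bind_bind {n m k : ℕ} (θ : L.Var → Term L m) (σ : Fin n → Term L m)
    (θ' : L.Var → Term L k) (σ' : Fin m → Term L k) (E : EqConstraint L n) :
    (E.bind θ σ).bind θ' σ' = E.bind (fun x => (θ x).bind θ' σ') (fun i => (σ i).bind θ' σ') := by
  induction E generalizing m k with
  | ex E ih => simp only [bind, ih, Term.shift_bind_lift, Term.lift_bind_lift]
  | _ => simp_all only [bind, Term.bind_bind]

theorem bind_id {n : ℕ} (E : EqConstraint L n) : E.bind .fvar .bvar = E := by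
  induction E with
  | ex E ih =>
    simp only [bind, Term.lift_bvar]
    exact congrArg ex ih
  | _ => simp_all only [bind, Term.bind_id]

theorem fv_bind_subset {n m : ℕ} {V : Set L.Var} (θ : L.Var → Term L m) (σ : Fin n → Term L m)
    (E : EqConstraint L n) (hθ : ∀ x ∈ E.fv, (θ x).fv ⊆ V) (hσ : ∀ i, (σ i).fv ⊆ V) :
    (E.bind θ σ).fv ⊆ V := by
  induction E generalizing m with
  | ex E ih =>
    exact ih _ _ (fun x hx => (Term.fv_shift_subset _).trans (hθ x hx)) (Term.fv_lift_subset hσ)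
  | conj E₁ E₂ ih₁ ih₂ =>
    exact Set.union_subset (ih₁ _ _ (fun x hx => hθ x (.inl hx)) hσ)
      (ih₂ _ _ (fun x hx => hθ x (.inr hx)) hσ)
  | _ =>
    exact Set.union_subset (Term.fv_bind_subset _ _ _ (fun x hx => hθ x (.inl hx)) hσ)
      (Term.fv_bind_subset _ _ _ (fun x hx => hθ x (.inr hx)) hσ)

/-- The substitution lemma of the semantics: substituting in the syntax amounts to changing the
valuation. Under an existential, the weakening of the substituted terms cancels against the new
value in the environment. -/
theorem holds_bind {n m : ℕ} (ρ : L.Scope → Option (Term L 0)) (σ : Subst L) (e : Fin m → Term L 0)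
    (θ : L.Var → Term L m) (τ : Fin n → Term L m) (E : EqConstraint L n) :
    (E.bind θ τ).Holds ρ σ e ↔
      E.Holds ρ (fun x => (θ x).bind σ e) (fun i => (τ i).bind σ e) := by
  induction E generalizing m with
  | ex E ih =>
    simp only [bind, Holds, ih, Term.shift_bind, Fin.cons_succ]
    refine exists_congr fun t => iff_of_eq (congrArg (fun e => Holds ρ _ e E) ?_)
    funext i
    refine Fin.cases ?_ (fun i => ?_) i
    · simp [Term.lift, Term.bind]
    · simp [Term.lift, Term.shift_bind]
  | _ => simp_all only [bind, Holds, Term.bind_bind]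

theorem holds_substBody (ρ : L.Scope → Option (Term L 0)) (σ : Subst L) (e : Fin 1 → Term L 0)
    (θ : Subst L) (E : EqConstraint L 1) :
    (E.substBody θ).Holds ρ σ e ↔ E.Holds ρ (θ.comp σ) e := by
  rw [substBody, holds_bind]
  refine iff_of_eq (congrArg₂ (fun σ e => Holds ρ σ e E) (funext fun x => ?_) rfl)
  rw [Term.shift_bind, Subst.comp, Term.subst]
  exact congrArg (Term.bind σ · (θ x)) (Subsingleton.elim _ _)

theorem substBody_fvar (E : EqConstraint L 1) : E.substBody .fvar = E := bind_id E

end EqConstraint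

/-! ### Substitution in set terms -/

namespace SetTerm

theorem bind_bind {n m k a b c : ℕ} (θ : L.Var → Term L m) (σ : Fin n → Term L m)
    (τ : Fin a → SetTerm L m b) (θ' : L.Var → Term L k) (σ' : Fin m → Term L k)
    (τ' : Fin b → SetTerm L k c) (ζ : SetTerm L n a) :
    (ζ.bind θ σ τ).bind θ' σ' τ' = ζ.bind (fun x => (θ x).bind θ' σ') (fun i => (σ i).bind θ' σ')
      (fun z => (τ z).bind θ' σ' τ') := by
  cases ζ with
  | svar z => rfl
  | lit ζ => simp [bind, Term.bind_bind]

theorem bind_id {n k : ℕ} (ζ : SetTerm L n k) : ζ.bind .fvar .bvar svar = ζ := by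
  cases ζ with
  | svar z => rfl
  | lit ζ => simp [bind, funext (Term.bind_id (L := L) (n := n))]

theorem shift_bind_shift {n m a b : ℕ} (θ : L.Var → Term L m) (σ : Fin n → Term L m)
    (τ : Fin a → SetTerm L m b) (ζ : SetTerm L n a) :
    ζ.shift.bind (fun x => (θ x).shift) (Term.lift σ) (fun z => (τ z).shift) =
      (ζ.bind θ σ τ).shift := by
  cases ζ with
  | svar z => rfl
  | lit ζ =>
    simp only [shift, bind, List.map_map]
    exact congrArg (fun f => lit (ζ.map f)) (funext fun t => Term.shift_bind_lift t θ σ)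

theorem lift_svar {n k : ℕ} : lift (svar : Fin k → SetTerm L n k) = svar := by
  funext i
  refine Fin.cases ?_ (fun i => ?_) i <;> simp [lift, bind]

theorem bind_svar_succ_bind {n m b c : ℕ} (θ : L.Var → Term L m) (σ : Fin n → Term L m)
    (τ' : Fin b → SetTerm L m c) (ζ : SetTerm L n b) :
    (ζ.bind .fvar .bvar (fun z => svar z.succ)).bind θ σ (lift τ') =
      (ζ.bind θ σ τ').bind .fvar .bvar (fun z => svar z.succ) := by
  cases ζ with
  | svar z => rfl
  | lit ζ => simp [bind, funext (Term.bind_id (L := L))]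

theorem lift_bind_lift {n m a b c : ℕ} (τ : Fin a → SetTerm L n b) (θ : L.Var → Term L m)
    (σ : Fin n → Term L m) (τ' : Fin b → SetTerm L m c) (z : Fin (a + 1)) :
    (lift τ z).bind θ σ (lift τ') = lift (fun z => (τ z).bind θ σ τ') z := by
  refine Fin.cases ?_ (fun z => ?_) z
  · simp [lift, bind]
  · have := bind_svar_succ_bind θ σ τ' (τ z)
    simpa only [lift, Fin.cons_succ] using this

theorem fv_bind_subset {n m a b : ℕ} {V : Set L.Var} (θ : L.Var → Term L m) (σ : Fin n → Term L m)
    (τ : Fin a → SetTerm L m b) (ζ : SetTerm L n a) (hθ : ∀ x ∈ ζ.fv, (θ x).fv ⊆ V)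
    (hσ : ∀ i, (σ i).fv ⊆ V) (hτ : ∀ z, (τ z).fv ⊆ V) : (ζ.bind θ σ τ).fv ⊆ V := by
  cases ζ with
  | svar z => exact hτ z
  | lit ζ =>
    rintro x ⟨t, ht, hx⟩
    obtain ⟨u, hu, rfl⟩ := List.mem_map.1 ht
    exact Term.fv_bind_subset θ σ u (fun y hy => hθ y ⟨u, hu, hy⟩) hσ hx

theorem fv_shift_subset {n k : ℕ} (ζ : SetTerm L n k) : ζ.shift.fv ⊆ ζ.fv :=
  fv_bind_subset _ _ _ ζ (fun x hx => by simpa [Term.fv] using hx) (fun i => by simp [Term.fv])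
    (fun z => by simp [fv])

theorem fv_lift_subset {n a b : ℕ} {V : Set L.Var} {τ : Fin a → SetTerm L n b}
    (hτ : ∀ z, (τ z).fv ⊆ V) (z : Fin (a + 1)) : (lift τ z).fv ⊆ V := by
  refine Fin.cases ?_ (fun z => ?_) z
  · simp [lift, fv]
  · refine fv_bind_subset _ _ _ (τ z) (fun x hx => ?_) (fun i => by simp [Term.fv])
      (fun z => by simp [fv])
    simpa [Term.fv] using hτ z hx

end SetTerm

/-! ### Substitution in constraints -/

namespace Constraint

theorem bind_bind {n m k a b c : ℕ} (θ : L.Var → Term L m) (σ : Fin n → Term L m)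
    (τ : Fin a → SetTerm L m b) (θ' : L.Var → Term L k) (σ' : Fin m → Term L k)
    (τ' : Fin b → SetTerm L k c) (C : Constraint L n a) :
    (C.bind θ σ τ).bind θ' σ' τ' = C.bind (fun x => (θ x).bind θ' σ') (fun i => (σ i).bind θ' σ')
      (fun z => (τ z).bind θ' σ' τ') := by
  induction C generalizing m k b c with
  | emp | fls => rfl
  | conj C₁ C₂ ih₁ ih₂ => simp only [bind, ih₁, ih₂]
  | query o t r E C ih =>
    simp only [bind, ih, Term.bind_bind, EqConstraint.bind_bind, Term.shift_bind_lift,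
      Term.lift_bind_lift, SetTerm.lift_bind_lift]
  | ex C ih =>
    simp only [bind, ih, Term.shift_bind_lift, Term.lift_bind_lift, SetTerm.shift_bind_shift]
  | all ζ C ih =>
    simp only [bind, ih, Term.shift_bind_lift, Term.lift_bind_lift, SetTerm.shift_bind_shift,
      SetTerm.bind_bind]
  | _ => simp only [bind, Term.bind_bind, SetTerm.bind_bind]

theorem bind_id {n k : ℕ} (C : Constraint L n k) : C.bind .fvar .bvar .svar = C := by
  induction C with
  | emp | fls => rfl
  | conj C₁ C₂ ih₁ ih₂ => simp only [bind, ih₁, ih₂]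
  | query o t r E C ih =>
    simp only [bind, ih, Term.bind_id, Term.lift_bvar, SetTerm.lift_svar]
    exact congrArg (query o t r · C) (EqConstraint.bind_id E)
  | ex C ih =>
    simp only [bind, Term.lift_bvar]
    exact congrArg ex ih
  | all ζ C ih =>
    simp only [bind, Term.lift_bvar, SetTerm.bind_id]
    exact congrArg (all ζ) ih
  | _ => simp only [bind, Term.bind_id, SetTerm.bind_id]

theorem fv_bind_subset {n m a b : ℕ} {V : Set L.Var} (θ : L.Var → Term L m) (σ : Fin n → Term L m)
    (τ : Fin a → SetTerm L m b) (C : Constraint L n a) (hθ : ∀ x ∈ C.fv, (θ x).fv ⊆ V)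
    (hσ : ∀ i, (σ i).fv ⊆ V) (hτ : ∀ z, (τ z).fv ⊆ V) : (C.bind θ σ τ).fv ⊆ V := by
  induction C generalizing m b with
  | emp | fls => exact Set.empty_subset _
  | conj C₁ C₂ ih₁ ih₂ =>
    exact Set.union_subset (ih₁ _ _ _ (fun x hx => hθ x (.inl hx)) hσ hτ)
      (ih₂ _ _ _ (fun x hx => hθ x (.inr hx)) hσ hτ)
  | query o t r E C ih =>
    refine Set.union_subset (Set.union_subset
      (Term.fv_bind_subset _ _ _ (fun x hx => hθ x (.inl (.inl hx))) hσ)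
      (EqConstraint.fv_bind_subset _ _ _
        (fun x hx => (Term.fv_shift_subset _).trans (hθ x (.inl (.inr hx))))
        (Term.fv_lift_subset hσ)))
      (ih _ _ _ (fun x hx => hθ x (.inr hx)) hσ (SetTerm.fv_lift_subset hτ))
  | ex C ih =>
    exact ih _ _ _ (fun x hx => (Term.fv_shift_subset _).trans (hθ x hx)) (Term.fv_lift_subset hσ)
      (fun z => (SetTerm.fv_shift_subset _).trans (hτ z))
  | all ζ C ih =>
    exact Set.union_subset (SetTerm.fv_bind_subset _ _ _ _ (fun x hx => hθ x (.inl hx)) hσ hτ)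
      (ih _ _ _ (fun x hx => (Term.fv_shift_subset _).trans (hθ x (.inr hx)))
        (Term.fv_lift_subset hσ) (fun z => (SetTerm.fv_shift_subset _).trans (hτ z)))
  | single t ζ =>
    exact Set.union_subset (Term.fv_bind_subset _ _ _ (fun x hx => hθ x (.inl hx)) hσ)
      (SetTerm.fv_bind_subset _ _ _ _ (fun x hx => hθ x (.inr hx)) hσ hτ)
  | pred P a ts =>
    exact Set.iUnion_subset fun i =>
      Term.fv_bind_subset _ _ _ (fun x hx => hθ x (Set.mem_iUnion.2 ⟨i, hx⟩)) hσ
  | _ =>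
    exact Set.union_subset (Term.fv_bind_subset _ _ _ (fun x hx => hθ x (.inl hx)) hσ)
      (Term.fv_bind_subset _ _ _ (fun x hx => hθ x (.inr hx)) hσ)

theorem subst_fvar {k : ℕ} (C : Constraint L 0 k) : C.subst .fvar = C := by
  rw [subst, Subsingleton.elim Fin.elim0 Term.bvar, bind_id]

/-- Guarantees that a pending query is still a query after a step, with substitution acting
separately on its source, body and continuation. -/
theorem subst_query (θ : Subst L) (o : PartialOrder L.Label) (t : Term L 0)
    (r : RegularExpression L.Label) (E : EqConstraint L 1) (C : Constraint L 0 1) :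
    (query o t r E C).subst θ = query o (t.subst θ) r (E.substBody θ) (C.subst θ) := by
  simp only [subst, bind, Subsingleton.elim (Fin.elim0 : Fin 0 → Term L 0) Term.bvar,
    Term.lift_bvar, SetTerm.lift_svar]
  simp only [Term.subst, EqConstraint.substBody,
    Subsingleton.elim (Fin.elim0 : Fin 0 → Term L 0) Term.bvar]

theorem subst_instSet (θ : Subst L) (C : Constraint L 0 1) (ζ : List (Term L 0)) :
    (C.instSet ζ).subst θ = (C.subst θ).instSet (ζ.map (Term.subst θ)) := by
  simp only [subst, instSet, bind_bind, Term.bind_fvar_elim0]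
  congr 1
  exact Subsingleton.elim _ _

theorem fv_instSet_subset (C : Constraint L 0 1) {ζ : List (Term L 0)} (hζ : ∀ t ∈ ζ, t.fv = ∅) :
    (C.instSet ζ).fv ⊆ C.fv := by
  refine fv_bind_subset _ _ _ C (fun x hx => by simpa [Term.fv] using hx) (fun i => i.elim0) ?_
  rintro - x ⟨t, ht, hx⟩
  simp [hζ t ht] at hx

end Constraint

/-- Paths consist of scopes and labels only. Hence answers are ground: substitutions fix them, and
inserting them introduces no variables. -/
theorem Path.fv_toTerm (p : Path L) : p.toTerm.fv = ∅ := by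
  induction p with
  | here s => simp [toTerm, Term.fv]
  | step s l p ih =>
    simp only [toTerm, Term.fv, Set.iUnion_eq_empty]
    intro j
    fin_cases j <;> simp [Term.fv, ih]

/-! ### Evolution of scope graphs -/

/-- `G'` arises from `Gθ` by addition of edges, of scopes, and of missing data. -/
structure ScopeGraph.Evolves (θ : Subst L) (G G' : ScopeGraph L) : Prop where
  edges : G.R ⊆ G'.R
  data : ∀ s d, G.ρ s = some d → G'.ρ s = some (d.subst θ)

/-- Only scopes of the graph have data. -/
def ScopeGraph.DataOnScopes (G : ScopeGraph L) : Prop := ∀ s ∉ G.S, G.ρ s = none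

theorem ScopeGraph.evolves_subst (θ : Subst L) (G : ScopeGraph L) : G.Evolves θ (G.subst θ) :=
  ⟨subset_rfl, fun s d h => by simp [subst, h]⟩

theorem ScopeGraph.evolves_refl (G : ScopeGraph L) : G.Evolves .fvar G :=
  ⟨subset_rfl, fun s d h => by rw [h, Term.subst_fvar]⟩

theorem ScopeGraph.DataOnScopes.subst {G : ScopeGraph L} (h : G.DataOnScopes) (θ : Subst L) :
    (G.subst θ).DataOnScopes := fun s hs => by simp [ScopeGraph.subst, h s hs]

theorem ScopeGraph.InData.evolves {θ : Subst L} {G G' : ScopeGraph L} (hG : G.Evolves θ G')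
    {t : Term L 0} {s : L.Scope} (h : G.InData t s) : G'.InData (t.subst θ) s := by
  obtain ⟨d, hd, ht⟩ := h
  exact ⟨_, hG.data s d hd, ht.bind θ _⟩

theorem Path.InGraph.mono {G G' : ScopeGraph L} (h : G.R ⊆ G'.R) {p : Path L} (hp : p.InGraph G) :
    p.InGraph G' := by
  induction p with
  | here s => trivial
  | step s l p ih => exact ⟨h hp.1, ih hp.2⟩

/-- A path of the larger graph either lies in the smaller graph, or follows a path of the smaller
graph up to a first new edge. -/
theorem Path.InGraph.inGraph_or_exists_new_edge {G G' : ScopeGraph L} {p : Path L}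
    (hp : p.InGraph G') : p.InGraph G ∨ ∃ (p₁ : Path L) (l : L.Label) (s : L.Scope),
      p₁.InGraph G ∧ p₁.src = p.src ∧ p₁.word ++ [l] <+: p.word ∧
        (p₁.tgt, l, s) ∈ G'.R ∧ (p₁.tgt, l, s) ∉ G.R := by
  induction p with
  | here s => exact .inl trivial
  | step s l p ih =>
    by_cases he : (s, l, p.src) ∈ G.R
    · rcases ih hp.2 with h | ⟨p₁, l₁, s₁, h₁, hs, hw, hn⟩
      · exact .inl ⟨he, h⟩
      · refine .inr ⟨.step s l p₁, l₁, s₁, ⟨hs ▸ he, h₁⟩, rfl, ?_, hn⟩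
        simpa [word] using hw
    · exact .inr ⟨.here s, l, p.src, trivial, rfl, by simp [word], hp.1, he⟩

/-! ### Stability of query answers -/

namespace Query

/-- No new edge of `G'` is reached by the search for an answer to `q` in `G`. -/
def NoCriticalEdge (q : Query L) (G G' : ScopeGraph L) : Prop :=
  ∀ s l s', q.Critical G s l → (s, l, s') ∈ G'.R → (s, l, s') ∈ G.R

/-- Otherwise the path would have a first new edge. The labels up to and including that edge spell a
prefix of `w`, which makes the edge critical. Allowing prefixes, rather than only full matches,
covers both answers and critical paths. -/
theorem NoCriticalEdge.inGraph {q : Query L} {G G' : ScopeGraph L} (h : q.NoCriticalEdge G G')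
    {p : Path L} (hp : p.InGraph G') (hs : p.src = q.src) {w : List L.Label}
    (hw : w ∈ q.re.matches') (hpw : p.word <+: w) : p.InGraph G := by
  rcases hp.inGraph_or_exists_new_edge (G := G) with hp | ⟨p₁, l, s, h₁, hs₁, hw₁, he, hn⟩
  · exact hp
  · exact absurd (h _ l s ⟨p₁, h₁, hs₁.trans hs, rfl, w, hw, hw₁.trans hpw⟩ he) hn

theorem NoCriticalEdge.reaches_iff {q : Query L} {G G' : ScopeGraph L}
    (h : q.NoCriticalEdge G G') (hR : G.R ⊆ G'.R) (p : Path L) :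
    q.Reaches G' p ↔ q.Reaches G p :=
  ⟨fun ⟨hp, hs, hw⟩ => ⟨h.inGraph hp hs hw List.prefix_rfl, hs, hw⟩,
    fun ⟨hp, hs, hw⟩ => ⟨hp.mono hR, hs, hw⟩⟩

theorem NoCriticalEdge.critical {q : Query L} {G G' : ScopeGraph L} (h : q.NoCriticalEdge G G')
    {s : L.Scope} {l : L.Label} (hc : q.Critical G' s l) : q.Critical G s l := by
  obtain ⟨p, hp, hs, ht, w, hw, hpw⟩ := hc
  exact ⟨p, h.inGraph hp hs hw ((List.prefix_append _ _).trans hpw), hs, ht, w, hw, hpw⟩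

/-- The identity valuation with the present data is one of the admissible completions, and both
answers are computed by it. -/
theorem IsAns.unique {q : Query L} {G : ScopeGraph L} {A A' : Set (Path L)} (h : q.IsAns G A)
    (h' : q.IsAns G A') : A = A' := by
  have hd : ∀ s d, G.ρ s = some d → G.ρ s = some (d.subst .fvar) :=
    fun s d h => by rw [h, Term.subst_fvar]
  rw [← h.2 .fvar G.ρ hd, h'.2 .fvar G.ρ hd]

/-- Every completion `σ` of the new graph yields the completion `θ.comp σ` of the old one, for which
the answer is already known. The absence of critical new edges makes the reachable paths, and
therefore the shadowing, the same. -/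
theorem IsAns.evolves {q : Query L} {G G' : ScopeGraph L} {A : Set (Path L)} {θ : Subst L}
    (h : q.IsAns G A) (hG : G.Evolves θ G') (hn : q.NoCriticalEdge G G') :
    (q.subst θ).IsAns G' A := by
  refine ⟨h.1, fun σ ρ hρ => ?_⟩
  rw [← h.2 (θ.comp σ) ρ fun s d hd => by rw [hρ s _ (hG.data s d hd), Term.subst_subst]]
  have hr : ∀ p, (q.subst θ).Reaches G' p ↔ q.Reaches G p := hn.reaches_iff hG.edges
  simp only [answer, hr]
  simp only [subst, EqConstraint.holds_substBody]

end Query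

theorem exists_represents {A : Set (Path L)} (h : A.Finite) : ∃ ζ, Represents ζ A := by
  classical
  refine ⟨h.toFinset.toList.map Path.toTerm, fun t => ?_⟩
  simp [eq_comm]

/-! ### Solver steps -/

section

variable {𝕊 : Spec L} {g : GuardPred L}

/-- Data is only added, not overwritten, because the new scope had none. This is what `DataOnScopes`
is maintained for. -/
theorem ScopeGraph.Evolves.upd_subst {S : Set L.Scope} {R : Set (L.Scope × L.Label × L.Scope)}
    {ρ : L.Scope → Option (Term L 0)} {s : L.Scope} (h : ρ s = none) (t : Term L 0)
    (θ : Subst L) :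
    Evolves θ ⟨S, R, ρ⟩ (ScopeGraph.subst θ ⟨insert s S, R, upd ρ s t⟩) := by
  refine ⟨subset_rfl, fun s' d hd => ?_⟩
  have : s' ≠ s := by rintro rfl; exact absurd (h.symm.trans hd) (by simp)
  have hd : ρ s' = some d := hd
  simp [ScopeGraph.subst, upd, this, hd]

/-- The effect of a solver step on the components of a configuration other than its constraints. -/
structure Config.Evolves (θ : Subst L) (κ κ' : Config L) : Prop where
  graph : κ.G.Evolves θ κ'.G
  dataOnScopes : κ'.G.DataOnScopes
  solved : ∀ q ∈ κ.solved, q.subst θ ∈ κ'.solved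

theorem Query.subst_fvar (q : Query L) : q.subst .fvar = q := by
  rw [subst, EqConstraint.substBody_fvar]

/-! ### Weakening guards and framing constraints -/

theorem Step.mono {g' : GuardPred L} (hg : ∀ G q C Γ, g G q C Γ → g' G q C Γ) {κ κ' : Config L}
    (h : Step 𝕊 g κ κ') : Step 𝕊 g' κ κ' := by
  cases h with
  | conj => exact .conj
  | emp => exact .emp
  | ex y hy => exact .ex y hy
  | eq θ h₁ h₂ => exact .eq θ h₁ h₂
  | single h => exact .single h
  | all ts h₁ h₂ => exact .all ts h₁ h₂
  | newScope s h₁ h₂ => exact .newScope s h₁ h₂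
  | edge => exact .edge
  | dataOf h => exact .dataOf h
  | query A ζ h₁ h₂ h₃ => exact .query A ζ h₁ h₂ (hg _ _ _ _ h₃)
  | pred D xs θ h₁ h₂ h₃ h₄ => exact .pred D xs θ h₁ h₂ h₃ h₄

theorem Expand.mono {g' : GuardPred L} (hg : ∀ G q C Γ, g G q C Γ → g' G q C Γ) {κ : Config L}
    {θ : Subst L} {H' : L.Hole → Option (List L.Scope × Term L 0)}
    (h : Expand 𝕊 g κ θ H') : Expand 𝕊 g' κ θ H' := by
  cases h with
  | pred D xs θ h₁ h₂ => exact .pred D xs θ h₁ h₂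
  | query h x sₜ ss t' s' s'' θ₁ θ₂ p h₁ h₂ h₃ h₄ h₅ h₆ h₇ h₈ h₉ h₁₀ h₁₁ =>
    exact .query h x sₜ ss t' s' s'' θ₁ θ₂ p h₁ h₂ h₃ h₄ h₅ h₆ h₇ h₈ h₉ h₁₀ (hg _ _ _ _ h₁₁)

/-- Transfers the freshness conditions of a step when a query beside it is replaced by its answered
continuation. -/
theorem Config.vars_replace_subset {G : ScopeGraph L} {c₁ c c' : Constraint L 0 0}
    {Γ : Multiset (Constraint L 0 0)} {U : L.Var → Option L.Hole}
    {H : L.Hole → Option (List L.Scope × Term L 0)} {Q : List (Query L)} (h : c'.fv ⊆ c.fv) :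
    Config.vars ⟨G, c₁ ::ₘ c' ::ₘ Γ, U, H, Q⟩ ⊆ Config.vars ⟨G, c₁ ::ₘ c ::ₘ Γ, U, H, Q⟩ := by
  rintro x (hx | ⟨C, hC, hx⟩ | hx)
  · exact .inl hx
  · simp only [Multiset.mem_cons] at hC
    rcases hC with rfl | rfl | hC
    · exact .inr (.inl ⟨C, by simp, hx⟩)
    · exact .inr (.inl ⟨c, by simp, h hx⟩)
    · exact .inr (.inl ⟨C, by simp [hC], hx⟩)
  · exact .inr (.inr hx)

theorem Rule.Unifies.mono {D : Rule L} {V W : Set L.Var} {P : L.Pred} {a : ℕ}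
    {ts : Fin a → Term L 0} {xs : Fin D.n → L.Var} {θ : Subst L} (h : D.Unifies W P a ts xs θ)
    (hV : V ⊆ W) : D.Unifies V P a ts xs θ :=
  ⟨h.1, h.2.1, fun i hi => h.2.2.1 i (hV hi), h.2.2.2⟩

/-- When a step consumes a constraint other than the framed query, both can be split off the
multiset. -/
theorem cons_eq_cons_of_ne {A : Type} {a b : A} {s t : Multiset A} (h : a ::ₘ s = b ::ₘ t)
    (hab : a ≠ b) : ∃ u, s = b ::ₘ u ∧ t = a ::ₘ u := by
  rcases Multiset.cons_eq_cons.1 h with h | ⟨-, h⟩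
  · exact absurd h.1 hab
  · exact h

/-- The step from `κ` to `κ'` leaves the constraint `c` next to `Γ` alone (but for the substitution
`θ`), and could also be made, without guards, with any constraint instead of `c` that does not
introduce variables. -/
def Step.Frames (𝕊 : Spec L) (κ κ' : Config L) (θ : Subst L) (c : Constraint L 0 0)
    (Γ : Multiset (Constraint L 0 0)) : Prop :=
  ∃ Γ', κ'.C = c.subst θ ::ₘ Γ' ∧ ∀ c' : Constraint L 0 0, c'.fv ⊆ c.fv →
    Step 𝕊 (fun _ _ _ _ => True) { κ with C := c' ::ₘ Γ } { κ' with C := c'.subst θ ::ₘ Γ' }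

/-- Next to the query `c`, a solver step either solves `c` or leaves it alone. -/
theorem Step.exists_evolves {κ κ' : Config L} (h : Step 𝕊 g κ κ') (hκ : κ.G.DataOnScopes) :
    ∃ θ, κ.Evolves θ κ' ∧ (∀ h, κ'.H h = (κ.H h).map (fun v => (v.1, v.2.subst θ))) ∧
      ∀ o t r E C Γ, κ.C = .query o t r E C ::ₘ Γ →
        (∃ s A ζ, t = .scope s ∧ Query.IsAns ⟨o, s, r, E⟩ κ.G A ∧ Represents ζ A ∧
          κ' = ⟨κ.G, C.instSet ζ ::ₘ Γ, κ.U, κ.H, ⟨o, s, r, E⟩ :: κ.solved⟩) ∨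
        Step.Frames 𝕊 κ κ' θ (.query o t r E C) Γ := by
  have hH : ∀ (H : L.Hole → Option (List L.Scope × Term L 0)) (h : L.Hole),
      H h = (H h).map (fun v => (v.1, v.2.subst .fvar)) := fun H h => by
    cases H h <;> simp [Term.subst_fvar]
  have hQ : ∀ (q : Query L) (Q : List (Query L)), q ∈ Q → q.subst .fvar ∈ Q := fun q Q hq => by
    rwa [Query.subst_fvar]
  have hθ : ∀ (θ : Subst L) (q : Query L) (Q : List (Query L)), q ∈ Q →
      q.subst θ ∈ Q.map (Query.subst θ) := fun θ q Q hq => List.mem_map_of_mem hq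
  cases h with
  | @conj G C₁ C₂ Δ =>
    refine ⟨.fvar, ⟨G.evolves_refl, hκ, fun q hq => hQ q _ hq⟩, hH _, ?_⟩
    intro o t r E C Γ hC
    obtain ⟨Λ, rfl, rfl⟩ := cons_eq_cons_of_ne hC (by simp)
    refine .inr ⟨C₁ ::ₘ C₂ ::ₘ Λ, ?_, fun c' _ => ?_⟩
    · simp only [Constraint.subst_fvar, Multiset.cons_swap (Constraint.query o t r E C)]
    · simp only [Constraint.subst_fvar, Multiset.cons_swap c']
      exact .conj
  | @emp G Δ =>
    refine ⟨.fvar, ⟨G.evolves_refl, hκ, fun q hq => hQ q _ hq⟩, hH _, ?_⟩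
    intro o t r E C Γ hC
    obtain ⟨Λ, rfl, rfl⟩ := cons_eq_cons_of_ne hC (by simp)
    refine .inr ⟨Λ, ?_, fun c' _ => ?_⟩
    · simp only [Constraint.subst_fvar]
    · simp only [Constraint.subst_fvar, Multiset.cons_swap c']
      exact .emp
  | @ex G C₁ Δ U H Q y hy =>
    refine ⟨.fvar, ⟨G.evolves_refl, hκ, fun q hq => hQ q _ hq⟩, hH _, ?_⟩
    intro o t r E C Γ hC
    obtain ⟨Λ, rfl, rfl⟩ := cons_eq_cons_of_ne hC (by simp)
    refine .inr ⟨C₁.inst (fun _ => .fvar y) ::ₘ Λ, ?_, fun c' hc' => ?_⟩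
    · simp only [Constraint.subst_fvar, Multiset.cons_swap (Constraint.query o t r E C)]
    · simp only [Constraint.subst_fvar, Multiset.cons_swap c']
      exact .ex y fun h => hy (Config.vars_replace_subset hc' h)
  | @single G t₁ ζ t' Δ U H Q h =>
    refine ⟨.fvar, ⟨G.evolves_refl, hκ, fun q hq => hQ q _ hq⟩, hH _, ?_⟩
    intro o t r E C Γ hC
    obtain ⟨Λ, rfl, rfl⟩ := cons_eq_cons_of_ne hC (by simp)
    refine .inr ⟨.eq t₁ t' ::ₘ Λ, ?_, fun c' _ => ?_⟩
    · simp only [Constraint.subst_fvar, Multiset.cons_swap (Constraint.query o t r E C)]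
    · simp only [Constraint.subst_fvar, Multiset.cons_swap c']
      exact .single h
  | @all G ζ C₁ Δ U H Q ts h₁ h₂ =>
    refine ⟨.fvar, ⟨G.evolves_refl, hκ, fun q hq => hQ q _ hq⟩, hH _, ?_⟩
    intro o t r E C Γ hC
    obtain ⟨Λ, rfl, rfl⟩ := cons_eq_cons_of_ne hC (by simp)
    refine .inr ⟨(ts.map fun t => C₁.inst (fun _ => t) : Multiset (Constraint L 0 0)) + Λ, ?_,
      fun c' _ => ?_⟩
    · simp only [Constraint.subst_fvar, Multiset.add_cons]
    · simp only [Constraint.subst_fvar, Multiset.cons_swap c', ← Multiset.add_cons]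
      exact .all ts h₁ h₂
  | @newScope S R ρ x t₁ Δ U H Q s hs hU =>
    refine ⟨_, ⟨.upd_subst (hκ s hs) t₁ _, ?_, fun q hq => hθ _ q _ hq⟩, fun _ => rfl, ?_⟩
    · refine ScopeGraph.DataOnScopes.subst (fun s' hs' => ?_) _
      simp only [Set.mem_insert_iff, not_or] at hs'
      simpa [upd, hs'.1] using hκ s' hs'.2
    intro o t r E C Γ hC
    obtain ⟨Λ, rfl, rfl⟩ := cons_eq_cons_of_ne hC (by simp)
    refine .inr ⟨_, Multiset.map_cons _ _ _, fun c' _ => ?_⟩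
    have := Step.newScope (𝕊 := 𝕊) (g := fun _ _ _ _ => True) (R := R) (ρ := ρ) (t := t₁)
      (Γ := c' ::ₘ Λ) (H := H) (Q := Q) s hs hU
    simpa only [Config.subst, Multiset.map_cons, Multiset.cons_swap c'] using this
  | @edge S R ρ s₁ l s₂ Δ =>
    refine ⟨.fvar, ⟨⟨Set.subset_insert _ _, fun s d h => by rw [h, Term.subst_fvar]⟩, hκ,
      fun q hq => hQ q _ hq⟩, hH _, ?_⟩
    intro o t r E C Γ hC
    obtain ⟨Λ, rfl, rfl⟩ := cons_eq_cons_of_ne hC (by simp)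
    refine .inr ⟨Λ, ?_, fun c' _ => ?_⟩
    · simp only [Constraint.subst_fvar]
    · simp only [Constraint.subst_fvar, Multiset.cons_swap c']
      exact .edge
  | @dataOf G s t₁ t₂ Δ U H Q h =>
    refine ⟨.fvar, ⟨G.evolves_refl, hκ, fun q hq => hQ q _ hq⟩, hH _, ?_⟩
    intro o t r E C Γ hC
    obtain ⟨Λ, rfl, rfl⟩ := cons_eq_cons_of_ne hC (by simp)
    refine .inr ⟨.eq t₁ t₂ ::ₘ Λ, ?_, fun c' _ => ?_⟩
    · simp only [Constraint.subst_fvar, Multiset.cons_swap (Constraint.query o t r E C)]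
    · simp only [Constraint.subst_fvar, Multiset.cons_swap c']
      exact .dataOf h
  | @query G o₁ s₁ r₁ E₁ C₁ Δ U H Q A ζ h₁ h₂ h₃ =>
    refine ⟨.fvar, ⟨G.evolves_refl, hκ, fun q hq => List.mem_cons_of_mem _ (hQ q _ hq)⟩, hH _, ?_⟩
    intro o t r E C Γ hC
    by_cases hne : Constraint.query o₁ (.scope s₁) r₁ E₁ C₁ = .query o t r E C
    · rw [hne] at hC
      obtain rfl := (Multiset.cons_inj_right _).1 hC
      simp only [Constraint.query.injEq] at hne
      obtain ⟨rfl, rfl, rfl, rfl, rfl⟩ := hne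
      exact .inl ⟨s₁, A, ζ, rfl, h₁, h₂, rfl⟩
    obtain ⟨Λ, rfl, rfl⟩ := cons_eq_cons_of_ne hC hne
    refine .inr ⟨C₁.instSet ζ ::ₘ Λ, ?_, fun c' _ => ?_⟩
    · simp only [Constraint.subst_fvar, Multiset.cons_swap (Constraint.query o t r E C)]
    · simp only [Constraint.subst_fvar, Multiset.cons_swap c']
      -- The guard of this other query was established next to `c`, not next to `c'`, so the framed
      -- step can only be claimed without guards. Future steps ignore guards as well.
      exact .query A ζ h₁ h₂ trivial
  | @eq G t₁ t₂ Δ U H Q θ h₁ h₂ =>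
    refine ⟨θ, ⟨G.evolves_subst _, hκ.subst θ, fun q hq => hθ θ q _ hq⟩, fun _ => rfl, ?_⟩
    intro o t r E C Γ hC
    obtain ⟨Λ, rfl, rfl⟩ := cons_eq_cons_of_ne hC (by simp)
    refine .inr ⟨_, Multiset.map_cons _ _ _, fun c' _ => ?_⟩
    have := Step.eq (𝕊 := 𝕊) (g := fun _ _ _ _ => True) (G := G)
      (Γ := c' ::ₘ Λ) (H := H) (Q := Q) θ h₁ h₂
    simpa only [Config.subst, Multiset.map_cons, Multiset.cons_swap c'] using this
  | @pred G P a ts Δ U H Q D xs θ h₁ h₂ h₃ h₄ =>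
    refine ⟨θ, ⟨G.evolves_subst _, hκ.subst θ, fun q hq => hθ θ q _ hq⟩, fun _ => rfl, ?_⟩
    intro o t r E C Γ hC
    obtain ⟨Λ, rfl, rfl⟩ := cons_eq_cons_of_ne hC (by simp)
    refine .inr ⟨((D.bodyAt xs) ::ₘ Λ).map (Constraint.subst θ), ?_, fun c' hc' => ?_⟩
    · simp only [Config.subst, Multiset.map_cons,
        Multiset.cons_swap ((Constraint.query o t r E C).subst θ)]
    · have := Step.pred (𝕊 := 𝕊) (g := fun _ _ _ _ => True) (G := G)
        (Γ := c' ::ₘ Λ) (H := H) (Q := Q) D xs θ h₁ h₂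
        (h₃.mono (Config.vars_replace_subset hc')) h₄
      simpa only [Config.subst, Multiset.map_cons, Multiset.cons_swap c',
        Multiset.cons_swap (c'.subst θ)] using this

end

/-! ### Links of composite paths -/

section

variable {𝕊 : Spec L}

/-- Future steps of `Γ` cannot create an edge that is reached by the search for an answer to `q`. -/
def Query.Safe (𝕊 : Spec L) (q : Query L) (G : ScopeGraph L) (Γ : Multiset (Constraint L 0 0)) :
    Prop :=
  ∀ s l, q.Critical G s l → ¬ MightExtend 𝕊 G Γ s l

/-- A single step is already a possible future, and safety excludes critical edges from every
future. -/
theorem Query.Safe.noCriticalEdge {q : Query L} {G G' : ScopeGraph L}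
    {Γ Γ' : Multiset (Constraint L 0 0)} (h : q.Safe 𝕊 G Γ)
    (hstep : FutureStep 𝕊 (G, Γ) (G', Γ')) : q.NoCriticalEdge G G' := by
  intro s l s' hc he
  by_contra hn
  exact h s l hc ⟨G', Γ', s', .single hstep, he, hn⟩

/-- A future of the new state is a future of the old one. Critical positions in the new graph are
critical in the old one, and an edge new to the larger graph is also new to the smaller. -/
theorem Query.Safe.step {q : Query L} {G G' : ScopeGraph L}
    {Γ Γ' : Multiset (Constraint L 0 0)} (h : q.Safe 𝕊 G Γ)
    (hstep : FutureStep 𝕊 (G, Γ) (G', Γ')) (hR : G.R ⊆ G'.R) (θ : Subst L) :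
    (q.subst θ).Safe 𝕊 G' Γ' := by
  rintro s l hc ⟨G'', Γ'', s', hsteps, he, hn⟩
  exact h s l ((h.noCriticalEdge hstep).critical hc)
    ⟨G'', Γ'', s', .head hstep hsteps, he, fun h => hn (hR h)⟩

/-- The constraint `query q as z. C`. -/
def Query.toConstraint (q : Query L) (C : Constraint L 0 1) : Constraint L 0 0 :=
  .query q.ord (.scope q.src) q.re q.wf C

theorem Query.subst_toConstraint (θ : Subst L) (q : Query L) (C : Constraint L 0 1) :
    (q.toConstraint C).subst θ = (q.subst θ).toConstraint (C.subst θ) :=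
  Constraint.subst_query θ _ _ _ _ _

theorem Query.fv_instSet_subset (q : Query L) (C : Constraint L 0 1) {A : Set (Path L)}
    {ζ : List (Term L 0)} (hζ : Represents ζ A) : (C.instSet ζ).fv ⊆ (q.toConstraint C).fv := by
  refine (C.fv_instSet_subset fun t ht => ?_).trans Set.subset_union_right
  obtain ⟨p, -, rfl⟩ := (hζ t).1 ht
  exact p.fv_toTerm

theorem Represents.subst_instSet {A : Set (Path L)} {ζ : List (Term L 0)} (hζ : Represents ζ A)
    (θ : Subst L) (C : Constraint L 0 1) : (C.instSet ζ).subst θ = (C.subst θ).instSet ζ := by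
  rw [Constraint.subst_instSet]
  congr 1
  conv_rhs => rw [← List.map_id ζ]
  refine List.map_congr_left fun t ht => ?_
  obtain ⟨p, -, rfl⟩ := (hζ t).1 ht
  exact Term.subst_eq_of_fv_eq_empty θ _ p.fv_toTerm

/-- The query `q` is solved, and its answer is final. -/
def Config.Solved (𝕊 : Spec L) (κ : Config L) (q : Query L) : Prop :=
  q ∈ κ.solved ∧ q.Safe 𝕊 κ.G κ.C

/-- The query `q` with answer `A` is guarded, and remains to be solved. -/
def Config.Pending (𝕊 : Spec L) (κ : Config L) (q : Query L) (A : Set (Path L)) : Prop :=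
  ∃ C Γ, κ.C = q.toConstraint C ::ₘ Γ ∧ ∀ ζ, Represents ζ A → q.Safe 𝕊 κ.G (C.instSet ζ ::ₘ Γ)

/-- A link of a composite path, the query of which may still have to be solved. -/
def Config.Linked (𝕊 : Spec L) (κ : Config L) (s₁ s₂ : L.Scope) : Prop :=
  ∃ q p A, q.src = s₁ ∧ q.IsAns κ.G A ∧ p ∈ A ∧ (p.tgt = s₂ ∨ κ.G.InData (.scope s₂) p.tgt) ∧
    (κ.Solved 𝕊 q ∨ κ.Pending 𝕊 q A)

/-- A pending query satisfies all premises of the solver rule for queries: its answer is defined and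
it is guarded. Consequently no expansion takes place while a query is pending, and no final
configuration has one. -/
theorem Config.Pending.exists_solve {κ : Config L} {q : Query L} {A : Set (Path L)}
    (h : κ.Pending 𝕊 q A) (hA : q.IsAns κ.G A) : ∃ κ', Solve 𝕊 κ κ' := by
  obtain ⟨C, Γ, hC, hs⟩ := h
  obtain ⟨ζ, hζ⟩ := exists_represents hA.1
  obtain ⟨G, C', U, H, Q⟩ := κ
  obtain rfl : C' = _ := hC
  refine ⟨_, Step.query A ζ hA hζ fun A' ζ' hA' hζ' => ?_⟩
  -- The guard ranges over all answers, but there is only one.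
  obtain rfl := hA'.unique hA
  exact hs ζ' hζ'

theorem FutureStep.of_solve {κ κ' : Config L} (h : Solve 𝕊 κ κ') :
    FutureStep 𝕊 (κ.G, κ.C) (κ'.G, κ'.C) :=
  .solve (h.mono fun _ _ _ _ _ => trivial)

theorem inData_scope_evolves {θ : Subst L} {G G' : ScopeGraph L} (hG : G.Evolves θ G')
    {p : Path L} {s : L.Scope} (h : p.tgt = s ∨ G.InData (.scope s) p.tgt) :
    p.tgt = s ∨ G'.InData (.scope s) p.tgt :=
  h.imp_right fun h => h.evolves hG

theorem Config.Solved.step {κ κ' : Config L} {θ : Subst L} {q : Query L} (h : κ.Solved 𝕊 q)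
    (hstep : FutureStep 𝕊 (κ.G, κ.C) (κ'.G, κ'.C)) (hev : κ.Evolves θ κ') :
    κ'.Solved 𝕊 (q.subst θ) :=
  ⟨hev.solved q h.1, h.2.step hstep hev.graph.edges θ⟩

/-- A solved query is safe for the actual constraints, so any future step preserves its link. For a
pending query safety concerns the answered continuation, so its fate is left to `hpending`. -/
theorem Config.Linked.step {κ κ' : Config L} {θ : Subst L} {s₁ s₂ : L.Scope}
    (h : κ.Linked 𝕊 s₁ s₂) (hstep : FutureStep 𝕊 (κ.G, κ.C) (κ'.G, κ'.C)) (hev : κ.Evolves θ κ')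
    (hpending : ∀ q A, q.IsAns κ.G A → κ.Pending 𝕊 q A →
      (κ'.G = κ.G ∧ κ'.Solved 𝕊 q) ∨
        (q.NoCriticalEdge κ.G κ'.G ∧ κ'.Pending 𝕊 (q.subst θ) A)) :
    κ'.Linked 𝕊 s₁ s₂ := by
  obtain ⟨q, p, A, hq, hA, hp, ht, h | h⟩ := h
  · exact ⟨q.subst θ, p, A, hq, hA.evolves hev.graph (h.2.noCriticalEdge hstep), hp,
      inData_scope_evolves hev.graph ht, .inl (h.step hstep hev)⟩
  · rcases hpending q A hA h with ⟨hG, h⟩ | ⟨hn, h⟩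
    · exact ⟨q, p, A, hq, hG ▸ hA, hp, inData_scope_evolves hev.graph ht, .inl h⟩
    · exact ⟨q.subst θ, p, A, hq, hA.evolves hev.graph hn, hp,
        inData_scope_evolves hev.graph ht, .inr h⟩

/-! ### The invariant -/

/-- What synthesis from `κ₀` preserves: the scopes recorded for a hole are linked, and end in the
scope that was recorded in `κ₀`. -/
structure Config.Invariant (𝕊 : Spec L) (κ₀ κ : Config L) : Prop where
  dataOnScopes : κ.G.DataOnScopes
  inData : ∀ t s, t.fv = ∅ → κ₀.G.InData t s → κ.G.InData t s
  holes : ∀ h, κ₀.H h ≠ none → κ.H h ≠ none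
  linked : ∀ h ss t, κ.H h = some (ss, t) → ss.IsChain (κ.Linked 𝕊) ∧
    ∃ s v, κ₀.H h = some ([s], v) ∧ ss.getLast? = some s

theorem ScopeGraph.InData.evolves_of_fv_eq_empty {θ : Subst L} {G G' : ScopeGraph L}
    (hG : G.Evolves θ G') {t : Term L 0} {s : L.Scope} (ht : t.fv = ∅) (h : G.InData t s) :
    G'.InData t s := by
  have := h.evolves hG
  rwa [Term.subst_eq_of_fv_eq_empty θ t ht] at this

/-- The delicate case is a step beside a pending query, whose safety speaks of a state in which the
query has been answered. Framing reproduces the step in that state. -/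
theorem Config.Invariant.solve {κ₀ κ κ' : Config L} (hκ : Config.Invariant 𝕊 κ₀ κ)
    (h : Solve 𝕊 κ κ') : Config.Invariant 𝕊 κ₀ κ' := by
  obtain ⟨θ, hev, hH, hq⟩ := Step.exists_evolves h hκ.dataOnScopes
  refine ⟨hev.dataOnScopes, fun t s ht hs => (hκ.inData t s ht hs).evolves_of_fv_eq_empty
    hev.graph ht, fun h hh => ?_, fun h' ss t ht => ?_⟩
  · simpa [hH] using hκ.holes h hh
  rw [hH, Option.map_eq_some_iff] at ht
  obtain ⟨⟨ss, t⟩, ht, hsst⟩ := ht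
  cases hsst
  obtain ⟨hc, hlast⟩ := hκ.linked h' ss t ht
  refine ⟨hc.imp fun s₁ s₂ hl => hl.step (.of_solve h) hev ?_, hlast⟩
  rintro q A hA ⟨C, Γ, hC, hs⟩
  rcases hq _ _ _ _ _ _ hC with ⟨s, A', ζ, hsc, hA', hζ, rfl⟩ | ⟨Γ', hC', hstep⟩
  -- The step solves the pending query. The answer used must be `A`, so safety next to the
  -- continuation becomes safety of the actual constraints.
  · cases hsc
    obtain rfl := hA'.unique hA
    exact .inl ⟨rfl, List.mem_cons_self, hs ζ hζ⟩
  · have hfuture : ∀ ζ, Represents ζ A → FutureStep 𝕊 (κ.G, C.instSet ζ ::ₘ Γ)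
        (κ'.G, (C.instSet ζ).subst θ ::ₘ Γ') := fun ζ hζ =>
      .solve (hstep (C.instSet ζ) (q.fv_instSet_subset C hζ))
    obtain ⟨ζ, hζ⟩ := exists_represents hA.1
    refine .inr ⟨(hs ζ hζ).noCriticalEdge (hfuture ζ hζ), C.subst θ, Γ', ?_, fun ζ hζ => ?_⟩
    · rw [hC', ← Query.subst_toConstraint]; rfl
    -- Answers are ground, so substituting before or after inserting them gives the same constraint.
    · rw [← hζ.subst_instSet]
      exact (hs ζ hζ).step (hfuture ζ hζ) hev.graph.edges θ

/-- Without a solver step no query is pending, so the link is solved. Its safety covers expansions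
because these count as future steps. -/
theorem Config.Linked.expand {κ : Config L} {θ : Subst L}
    {H' : L.Hole → Option (List L.Scope × Term L 0)} {s₁ s₂ : L.Scope}
    (h : κ.Linked 𝕊 s₁ s₂) (hκ : κ.G.DataOnScopes) (hsolve : ¬ ∃ κ', Solve 𝕊 κ κ')
    (hE : Expand 𝕊 (guard 𝕊) κ θ H') :
    Config.Linked 𝕊 (Config.subst θ { κ with H := H' }) s₁ s₂ :=
  h.step (.expand (hE.mono fun _ _ _ _ _ => trivial))
    ⟨ScopeGraph.evolves_subst θ _, hκ.subst θ, fun _ hq => List.mem_map_of_mem hq⟩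
    fun _ _ hA hp => absurd (hp.exists_solve hA) hsolve

theorem Config.Invariant.expand {κ₀ κ κ' : Config L} (hκ : Config.Invariant 𝕊 κ₀ κ)
    (hsolve : ¬ ∃ κ', Solve 𝕊 κ κ') (h : κ' ∈ expansions 𝕊 κ) : Config.Invariant 𝕊 κ₀ κ' := by
  obtain ⟨θ, H', hE, -, rfl⟩ := h
  have hchain : ∀ ss : List L.Scope, ss.IsChain (κ.Linked 𝕊) →
      ss.IsChain (Config.Linked 𝕊 (Config.subst θ { κ with H := H' })) := fun ss hss =>
    hss.imp fun s₁ s₂ hl => hl.expand hκ.dataOnScopes hsolve hE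
  refine ⟨hκ.dataOnScopes.subst θ, fun t s ht hs => (hκ.inData t s ht hs).evolves_of_fv_eq_empty
    (ScopeGraph.evolves_subst θ _) ht, fun h hh => ?_, fun h ss t ht => ?_⟩
  · have := hκ.holes h hh
    cases hE with
    | pred => simpa [Config.subst] using this
    | query h' =>
      by_cases hh' : h = h' <;> simp_all [Config.subst, upd]
  simp only [Config.subst, Option.map_eq_some_iff] at ht
  obtain ⟨⟨ss, t⟩, ht, hsst⟩ := ht
  cases hsst
  cases hE with
  | pred => exact (hκ.linked h ss t ht).imp_left (hchain ss)
  | @query G o t₀ r E C Γ U H Q h' x sₜ ss₁ t₁ s' s'' θ₁ θ₂ p _ _ hh' _ _ hmgu hs'' _ hp htgt hg =>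
    by_cases hhh' : h = h'
    · subst hhh'
      simp only [upd, Function.update_self, Option.some.injEq, Prod.mk.injEq] at ht
      obtain ⟨rfl, rfl⟩ := ht
      obtain ⟨hc, s, v, hv, hlast⟩ := hκ.linked h _ _ hh'
      refine ⟨.cons_cons ?_ (hchain _ hc), s, v, hv, by simpa using hlast⟩
      obtain ⟨A, hA, hpA⟩ := hp
      -- The new link is witnessed by the expanded query itself. The answer and guard premises of
      -- the expansion refer to the graph and constraints after the substitution, exactly as
      -- `Pending` requires.
      refine ⟨⟨o, s', r, E.substBody (θ₁.comp θ₂)⟩, p, A, rfl, hA, hpA, ?_, .inr ⟨_, _, ?_,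
        fun ζ hζ => hg A ζ hA hζ⟩⟩
      · subst htgt
        exact inData_scope_evolves (ScopeGraph.evolves_subst _ _) (hs''.imp_left Eq.symm)
      · have ht₀ : t₀.subst (θ₁.comp θ₂) = .scope s' := by
          rw [← Term.subst_subst, hmgu.1 ()]; rfl
        simp only [Config.subst, Multiset.map_cons, Constraint.subst_query, ht₀]
        rfl
    · simp only [upd, ne_eq, hhh', not_false_eq_true, Function.update_of_ne] at ht
      exact (hκ.linked h ss t ht).imp_left (hchain ss)

/-! ### From links to composite paths -/

theorem Config.Linked.compositePath {κ : Config L} (hpending : ∀ q A, q.IsAns κ.G A →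
    ¬ κ.Pending 𝕊 q A) (s : L.Scope) (ss : List L.Scope)
    (h : (s :: ss).IsChain (κ.Linked 𝕊)) : CompositePath κ (s :: ss) := by
  induction ss generalizing s with
  | nil => exact .single s
  | cons s₂ ss ih =>
    rw [List.isChain_cons_cons] at h
    obtain ⟨⟨q, p, A, hq, hA, hp, ht, hs⟩, hc⟩ := h
    exact .comp q p (hs.resolve_right (hpending q A hA)).1 hq ⟨A, hA, hp⟩ ht (ih s₂ hc)

theorem Config.Invariant.wellFormedH {κ₀ κ : Config L} (hκ : Config.Invariant 𝕊 κ₀ κ)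
    (hpending : ∀ q A, q.IsAns κ.G A → ¬ κ.Pending 𝕊 q A) : WellFormedH κ := by
  intro h ss t ht
  obtain ⟨hc, s, v, -, hlast⟩ := hκ.linked h ss t ht
  cases ss with
  | nil => simp at hlast
  | cons s ss => exact Config.Linked.compositePath hpending s ss hc

/-! ### The invariant along runs of the synthesizer -/

theorem Config.Invariant.synthStep {κ₀ : Config L} {K K' : Set (Config L)}
    (hK : ∀ κ ∈ K, Config.Invariant 𝕊 κ₀ κ) (h : SynthStep 𝕊 K K') :
    ∀ κ ∈ K', Config.Invariant 𝕊 κ₀ κ := by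
  cases h with
  | solve hκ h =>
    rintro _ (rfl | h')
    · exact (hK _ hκ).solve h
    · exact hK _ h'.1
  | expand hκ hsolve _ =>
    rintro _ (h | h)
    · exact (hK _ hκ).expand hsolve h
    · exact hK _ h.1

theorem Config.Invariant.synth {κ₀ κ κ' : Config L} (hκ : Config.Invariant 𝕊 κ₀ κ)
    (h : ReflTransGen (Synth 𝕊) κ κ') : Config.Invariant 𝕊 κ₀ κ' := by
  induction h with
  | refl => exact hκ
  | tail _ h ih =>
    obtain ⟨K', hK', hmem⟩ := h
    refine Config.Invariant.synthStep ?_ hK' _ hmem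
    rintro _ rfl
    exact ih

theorem Config.Invariant.reflTransGen_synthStep {κ₀ : Config L} {K K' : Set (Config L)}
    (hK : ∀ κ ∈ K, Config.Invariant 𝕊 κ₀ κ) (h : ReflTransGen (SynthStep 𝕊) K K') :
    ∀ κ ∈ K', Config.Invariant 𝕊 κ₀ κ := by
  induction h with
  | refl => exact hK
  | tail _ h ih => exact Config.Invariant.synthStep ih h

/-- Initially each recorded sequence is a single scope, so there is no link to justify. Only
`DataOnScopes` has to be followed through the preliminary solver run from the empty graph. -/
theorem InitializedBySynthesize.invariant {P₀ : L.Pred} {P : LockedProgram L}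
    {xs : Fin P.n → L.Var} {hs : Fin P.n → L.Hole} {κ₀ : Config L}
    (h : InitializedBySynthesize 𝕊 P₀ P xs hs κ₀) : Config.Invariant 𝕊 κ₀ κ₀ := by
  obtain ⟨⟨κ, κ', hstart, hsteps, hκ₀⟩, -, hH⟩ := h
  have hdata : κ'.G.DataOnScopes := by
    clear hκ₀
    induction hsteps with
    | refl => rw [hstart.2.2.1]; exact fun _ _ => rfl
    | tail _ h ih =>
      obtain ⟨θ, hev, -⟩ := Step.exists_evolves h ih
      exact hev.dataOnScopes
  refine ⟨by rw [hκ₀]; exact hdata, fun _ _ _ h => h, fun _ h => h, fun h ss t hh => ?_⟩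
  obtain ⟨i, s, -, -, hv⟩ := hH h _ hh
  cases hv
  exact ⟨.singleton s, s, _, hh, rfl⟩

end

end RefSynth

/-- In the first part, `κ₁` is reached by exhaustively applying the synthesis relation: the scopes
recorded for each hole form a composite path, which ends in a scope of the declaration that the hole
was locked to. In the second part, a program `P'` is synthesized from an accepted configuration: every
synthesized reference is the term recorded for its hole together with such a path. -/
theorem mainTheorem2 (L : Symbols) (𝕊 : Spec L) (P₀ : L.Pred) (P : LockedProgram L)
    (xs : Fin P.n → L.Var) (hs : Fin P.n → L.Hole) (κ₀ κ₁ : Config L) :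
    (InitializedBySynthesize 𝕊 P₀ P xs hs κ₀ → Exhaustively (Synth 𝕊) κ₀ κ₁ →
      WellFormedH κ₁ ∧
      ∀ h ss t, κ₁.H h = some (ss, t) → ∃ i s, h = hs i ∧
        κ₀.H h = some ([s], .fvar (xs i)) ∧ ss.getLast? = some s ∧
        κ₁.G.InData (P.decl i) s) ∧
    (∀ P' : Term L 0, Synthesizes 𝕊 P₀ P xs hs κ₀ κ₁ P' →
      P' = P.fill (reference xs hs κ₁) ∧
      ∀ i, (∃ s, κ₀.G.InData (P.decl i) s) → ∃ ss s,
        κ₁.H (hs i) = some (ss, reference xs hs κ₁ i) ∧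
        1 < ss.length ∧ CompositePath κ₁ ss ∧
        κ₀.H (hs i) = some ([s], .fvar (xs i)) ∧ ss.getLast? = some s ∧
        κ₁.G.InData (P.decl i) s) := by
  refine ⟨fun hinit hex => ?_, fun P' hP' => ?_⟩
  · have hinv := hinit.invariant.synth hex.1
    refine ⟨hinv.wellFormedH fun q A hA hp => ?_, fun h ss t ht => ?_⟩
    · obtain ⟨κ', hκ'⟩ := hp.exists_solve hA
      -- A pending query would allow another solver step, contrary to exhaustiveness.
      exact hex.2 ⟨κ', _, .solve rfl hκ', Set.mem_insert _ _⟩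
    · obtain ⟨-, s, v, hv, hlast⟩ := hinv.linked h ss t ht
      obtain ⟨i, s', rfl, hdata, hv'⟩ := hinit.2.2 h _ hv
      cases hv'
      exact ⟨i, s, rfl, hv, hlast, hinv.inData _ _ (P.ground.2 i) hdata⟩
  · obtain ⟨hinit, ⟨K, hK, hmem⟩, hacc, rfl⟩ := hP'
    refine ⟨rfl, fun i hi => ?_⟩
    have hinv : Config.Invariant 𝕊 κ₀ κ₁ := Config.Invariant.reflTransGen_synthStep
      (by rintro _ rfl; exact hinit.invariant) hK κ₁ hmem
    obtain ⟨⟨ss, t⟩, ht⟩ := Option.ne_none_iff_exists'.1 (hinv.holes _ (hinit.2.1 i hi))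
    obtain ⟨-, s, v, hv, hlast⟩ := hinv.linked _ ss t ht
    obtain ⟨j, s', hj, hdata, hv'⟩ := hinit.2.2 _ _ hv
    cases hv'
    obtain ⟨⟨κ, κ', hstart, -, -⟩, -⟩ := hinit
    -- The holes are distinct, so the declaration found for this hole is the one with index `i`.
    obtain rfl := hstart.2.1 hj
    refine ⟨ss, s, ?_, hacc.2 _ _ _ ht, ?_, hv, hlast, hinv.inData _ _ (P.ground.2 i) hdata⟩
    · simp only [reference, ht]
    · refine hinv.wellFormedH (fun q A _ ⟨C, Γ, hC, _⟩ => ?_) _ _ _ ht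
      -- An accepted configuration has no constraints, hence no pending query. Exhaustiveness of the
      -- run is not needed.
      exact Multiset.cons_ne_zero (hC.symm.trans hacc.1)
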